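/- Let $K$ be a field, $N\ge 1$, and let $q,Q,Q_0\in K$ be nonzero elements such that $[m]:=\sum_{i=0}^{m-1}q^{m-1-2i}\neq 0$ for $1\le m\le N$ (for instance $q$ an indeterminate, or $q$ not a root of unity). Operators. Let $V_1=Kv_1\oplus Kv_{-1}$. On $V_1^{\otimes N}$, for $1\le i\le N-1$ let $e_i$ act on the $i$-th and $(i+1)$-th tensor factors by $v_1\otimes v_{-1}\mapsto -q^{-1}v_1\otimes v_{-1}+v_{-1}\otimes v_1$, $v_{-1}\otimes v_1\mapsto v_1\otimes v_{-1}-q\,v_{-1}\otimes v_1$, $v_{\pm1}\otimes v_{\pm1}\mapsto 0$; let $e_N$ act on the last factor by $v_1\mapsto -Q^{-1}v_1+v_{-1}$, $v_{-1}\mapsto v_1-Qv_{-1}$; and let $e_0$ act on the first factor by $v_1\mapsto -Q_0v_1+v_{-1}$, $v_{-1}\mapsto v_1-Q_0^{-1}v_{-1}$. For $a_0,a_N\in K$ put $$H^{2B}=-\sum_{i=1}^{N-1}e_i-a_Ne_N-a_0e_0 .$$ Diagrams of type A. Let $b\in\{+,-\}^N$; regard each $+$ as an up arrow and each $-$ as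 a down arrow. Repeatedly connect by an arc a down arrow and an up arrow, in this order from left to right, that are adjacent once the arrows already connected are disregarded, until all unpaired up arrows are to the left of all unpaired down arrows. The resulting diagram $D$ has a set $S$ of arcs, a set $S_\uparrow$ of unpaired up arrows and a set $S_\downarrow$ of unpaired down arrows. Let $|D\rangle\in V_1^{\otimes N}$ be the Kazhdan--Lusztig basis vector of type A, i.e. the tensor product of $v_{-1}\otimes v_1-q^{-1}v_1\otimes v_{-1}$ (at the two end positions) for each arc, $v_1$ for each unpaired up arrow and $v_{-1}$ for each unpaired down arrow. The vector $\Psi$. Let $d=|S_\uparrow|+|S|$. For $A\in S\cup S_\downarrow$ let $N_A$ be its number when unpaired up arrows, unpaired down arrows and arcs are enumerated together by $1,2,\ldots$ from left to right, arcs being ordered by their left ends; for $C\in S_\downarrow$ let $N'_C$ be its number when unpaired down arrows and arcs are enumerated from right to left, arcs being ordered by their right ends; for an arc $B$ from position $i$ to position $j>i$ let $m_B=(j-i+1)/2$. Put $$\Psi_D=q^{d(d-1)/2}Q^{d}\prod_{A\in S\cup S_\downarrow}[N_A]\prod_{B\in S}[m_B]^{-1}\prod_{C\in S_\downarrow}[N'_C]^{-1},\qquad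 \Psi=\sum_{D}\Psi_D\,|D\rangle ,$$ the sum being over the diagrams of all $b\in\{+,-\}^N$. Statement. If the integrable condition $q^{N-1}QQ_0=1$ holds, then $e_0\Psi=0$. Moreover, under this condition, for all $a_0,a_N\in K$, $\Psi$ is an eigenvector of $H^{2B}$ with eigenvalue zero, i.e. $\Psi\neq 0$ and $H^{2B}\Psi=0$. -/

import Mathlib

open scoped BigOperators

noncomputable section

namespace TwoBoundaryTL

/-- Binary strings of length `N`; `true` is `+` (up arrow, `v₁`), `false` is `-`
(down arrow, `v₋₁`). -/
abbrev Word (N : ℕ) : Type := Fin N → Bool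

/-- The space `V₁^{⊗N}`, in coordinates with respect to the standard basis
`v_{ε₁} ⊗ ⋯ ⊗ v_{ε_N}`, `ε ∈ {±}^N`. -/
abbrev State (K : Type*) (N : ℕ) : Type _ := Word N → K

/-! ### Generators and Hamiltonian -/

section Operators

variable {K : Type*} [Field K]

/-- The `4 × 4` matrix of the bulk generators on `V₁ ⊗ V₁`. -/
def bulkMatrix (q : K) : Matrix (Bool × Bool) (Bool × Bool) K
  | (true, false), (true, false) => -q⁻¹
  | (true, false), (false, true) => 1
  | (false, true), (true, false) => 1
  | (false, true), (false, true) => -q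
  | _, _ => 0

/-- The `2 × 2` matrix of the right boundary generator. -/
def rightMatrix (Q : K) : Matrix Bool Bool K
  | true, true => -Q⁻¹
  | false, false => -Q
  | _, _ => 1

/-- The `2 × 2` matrix of the left boundary generator. -/
def leftMatrix (Q₀ : K) : Matrix Bool Bool K
  | true, true => -Q₀
  | false, false => -Q₀⁻¹
  | _, _ => 1

/-- `1 ⊗ ⋯ ⊗ A ⊗ ⋯ ⊗ 1` with `A` acting on the tensor factor `i`. -/
def onSite {N : ℕ} (i : Fin N) (A : Matrix Bool Bool K) : Module.End K (State K N) :=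
  Matrix.toLin' (Matrix.of fun ε η : Word N =>
    if ∀ k, k ≠ i → ε k = η k then A (ε i) (η i) else 0)

/-- `1 ⊗ ⋯ ⊗ A ⊗ ⋯ ⊗ 1` with `A` acting on the tensor factors `i` and `j`. -/
def onSites {N : ℕ} (i j : Fin N) (A : Matrix (Bool × Bool) (Bool × Bool) K) :
    Module.End K (State K N) :=
  Matrix.toLin' (Matrix.of fun ε η : Word N =>
    if ∀ k, k ≠ i → k ≠ j → ε k = η k then A (ε i, ε j) (η i, η j) else 0)

/-- The bulk generators on `N = n + 1` sites: for `i : Fin n` (counted from `0`) this is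
`e_{i+1}`, acting on the neighbouring tensor factors `i + 1` and `i + 2` (counted from `1`). -/
def eBulk {n : ℕ} (q : K) (i : Fin n) : Module.End K (State K (n + 1)) :=
  onSites i.castSucc i.succ (bulkMatrix q)

/-- The right boundary generator `e_N`, `N = n + 1`. -/
def eRight (n : ℕ) (Q : K) : Module.End K (State K (n + 1)) :=
  onSite (Fin.last n) (rightMatrix Q)

/-- The left boundary generator `e_0` on `N = n + 1` sites. -/
def eLeft (n : ℕ) (Q₀ : K) : Module.End K (State K (n + 1)) :=
  onSite 0 (leftMatrix Q₀)

/-- The one-boundary Hamiltonian `-∑_{i=1}^{N-1} e_i - a_N e_N`, `N = n + 1`. -/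
def H1B (n : ℕ) (q Q aN : K) : Module.End K (State K (n + 1)) :=
  -(∑ i : Fin n, eBulk q i) - aN • eRight n Q

/-- The two-boundary Hamiltonian `H^{1B} - a_0 e_0`. -/
def H2B (n : ℕ) (q Q Q₀ a₀ aN : K) : Module.End K (State K (n + 1)) :=
  H1B n q Q aN - a₀ • eLeft n Q₀

end Operators

/-! ### Diagrams of type A -/

/-- `IsArc b i j`: in the diagram of `b`, the down arrow `i` and the up arrow `j > i` are
connected by an arc. An arc joins a down arrow and a later up arrow which are adjacent once
the arrows already connected to each other in between are disregarded; here `p k` is the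
arrow strictly between `i` and `j` to which `k` is already connected. -/
inductive IsArc {N : ℕ} (b : Word N) : Fin N → Fin N → Prop
  | mk (i j : Fin N) (hij : i < j) (hi : b i = false) (hj : b j = true)
      (p : Fin N → Fin N) (hp : ∀ k, i < k → k < j → i < p k ∧ p k < j)
      (hdown : ∀ k, i < k → k < j → b k = false → IsArc b k (p k))
      (hup : ∀ k, i < k → k < j → b k = true → IsArc b (p k) k) :
      IsArc b i j

/-- The arrow at position `i` does not belong to an arc. -/
def IsUnpaired {N : ℕ} (b : Word N) (i : Fin N) : Prop :=
  ∀ j, ¬ IsArc b i j ∧ ¬ IsArc b j i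

open Classical in
/-- The set `S` of arcs. -/
def arcs {N : ℕ} (b : Word N) : Finset (Fin N × Fin N) :=
  Finset.univ.filter fun p => IsArc b p.1 p.2

open Classical in
/-- The set `S_↑` of unpaired up arrows. -/
def upArrows {N : ℕ} (b : Word N) : Finset (Fin N) :=
  Finset.univ.filter fun i => IsUnpaired b i ∧ b i = true

open Classical in
/-- The set `S_↓` of unpaired down arrows. -/
def downArrows {N : ℕ} (b : Word N) : Finset (Fin N) :=
  Finset.univ.filter fun i => IsUnpaired b i ∧ b i = false

/-- The number of unpaired arrows and arcs which begin (from the left) at a position `≤ i`.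
If an unpaired arrow is at `i`, or an arc has left end `i`, this is its number in the
enumeration of up arrows, down arrows and arcs from the left (from outside to inside for
nested arcs). -/
def leftLabel {N : ℕ} (b : Word N) (i : Fin N) : ℕ :=
  ((upArrows b).filter fun k => k ≤ i).card + ((downArrows b).filter fun k => k ≤ i).card
    + ((arcs b).filter fun p => p.1 ≤ i).card

/-- The number of unpaired down arrows and arcs which begin (from the right) at a position
`≥ i`. If an unpaired down arrow is at `i`, this is its number in the enumeration of down
arrows and arcs from the right. -/
def rightLabel {N : ℕ} (b : Word N) (i : Fin N) : ℕ :=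
  ((downArrows b).filter fun k => i ≤ k).card + ((arcs b).filter fun p => i ≤ p.2).card

section Vectors

variable {K : Type*} [Field K]

/-- The quantum integer `[m] = ∑_{i=0}^{m-1} q^{m-1-2i}`. -/
def quantumInt (q : K) (m : ℕ) : K :=
  ∑ i ∈ Finset.range m, q ^ ((m : ℤ) - 1 - 2 * (i : ℤ))

/-- Coordinates of the vector `v₋₁ ⊗ v₁ - q⁻¹ v₁ ⊗ v₋₁` of an arc. -/
def arcCoeff (q : K) : Bool → Bool → K
  | false, true => 1
  | true, false => -q⁻¹
  | _, _ => 0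

/-- The type A Kazhdan--Lusztig basis vector of `b`: the tensor product of the vectors of its
arcs, of `v₁` for each unpaired up arrow and of `v₋₁` for each unpaired down arrow. -/
def klVector {N : ℕ} (q : K) (b : Word N) : State K N := fun ε =>
  (∏ p ∈ arcs b, arcCoeff q (ε p.1) (ε p.2)) *
    (∏ i ∈ upArrows b, if ε i = true then 1 else 0) *
    (∏ i ∈ downArrows b, if ε i = false then 1 else 0)

/-- The number `d = |S_↑| + |S|`. -/
def psiDeg {N : ℕ} (b : Word N) : ℕ := (upArrows b).card + (arcs b).card

/-- The factor `N₁ = q^{d(d-1)/2} Q^d`. -/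
def psiN1 {N : ℕ} (q Q : K) (b : Word N) : K :=
  q ^ (psiDeg b * (psiDeg b - 1) / 2) * Q ^ psiDeg b

/-- The factor `N₂ = ∏_{A ∈ S ∪ S_↓} [N_A]`, with the enumeration from the left. -/
def psiN2 {N : ℕ} (q : K) (b : Word N) : K :=
  (∏ p ∈ arcs b, quantumInt q (leftLabel b p.1)) *
    ∏ i ∈ downArrows b, quantumInt q (leftLabel b i)

/-- The factor `N₃ = ∏_{B ∈ S} [m_B]⁻¹`, where `m_B = (j - i + 1) / 2` is the size of the
arc from `i` to `j`. -/
def psiN3 {N : ℕ} (q : K) (b : Word N) : K :=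
  ∏ p ∈ arcs b, (quantumInt q (((p.2 : ℕ) - (p.1 : ℕ) + 1) / 2))⁻¹

/-- The factor `N₄ = ∏_{C ∈ S_↓} [N_C]⁻¹`, with the enumeration from the right. -/
def psiN4 {N : ℕ} (q : K) (b : Word N) : K :=
  ∏ i ∈ downArrows b, (quantumInt q (rightLabel b i))⁻¹

/-- The vector `Ψ = ∑_D Ψ_D |D⟩`, `Ψ_D = N₁ N₂ N₃ N₄`, of type A. -/
def Psi (N : ℕ) (q Q : K) : State K N :=
  ∑ b : Word N, (psiN1 q Q b * psiN2 q b * psiN3 q b * psiN4 q b) • klVector q b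

end Vectors

end TwoBoundaryTL

end

open scoped BigOperators

noncomputable section

namespace TwoBoundaryTL

section ArcCombinatorics

variable {N : ℕ} {b : Word N}

theorem IsArc.lt {i j : Fin N} (h : IsArc b i j) : i < j := by
  cases h; assumption

theorem IsArc.left_eq {i j : Fin N} (h : IsArc b i j) : b i = false := by
  cases h; assumption

theorem IsArc.right_eq {i j : Fin N} (h : IsArc b i j) : b j = true := by
  cases h; assumption

theorem IsArc.exists_right {i j k : Fin N} (h : IsArc b i j) (hik : i < k) (hkj : k < j)
    (hk : b k = false) : ∃ l, l < j ∧ IsArc b k l := by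
  cases h with
  | mk _ _ hij hi hj p hp hdown hup => exact ⟨p k, (hp k hik hkj).2, hdown k hik hkj hk⟩

theorem IsArc.exists_left {i j k : Fin N} (h : IsArc b i j) (hik : i < k) (hkj : k < j)
    (hk : b k = true) : ∃ l, i < l ∧ IsArc b l k := by
  cases h with
  | mk _ _ hij hi hj p hp hdown hup => exact ⟨p k, (hp k hik hkj).1, hup k hik hkj hk⟩

theorem isArc_of_forall_between {i j : Fin N} (hij : i < j) (hi : b i = false) (hj : b j = true)
    (h : ∀ k, i < k → k < j → ∃ l, i < l ∧ l < j ∧ (IsArc b k l ∨ IsArc b l k)) :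
    IsArc b i j := by
  choose! p hp using h
  refine .mk i j hij hi hj p (fun k h1 h2 => ⟨(hp k h1 h2).1, (hp k h1 h2).2.1⟩) ?_ ?_
  · intro k h1 h2 hk
    rcases (hp k h1 h2).2.2 with h | h
    · exact h
    · simp [h.right_eq] at hk
  · intro k h1 h2 hk
    rcases (hp k h1 h2).2.2 with h | h
    · simp [h.left_eq] at hk
    · exact h

theorem IsArc.congr {b' : Word N} {i j : Fin N} (h : IsArc b i j)
    (hb : ∀ k, i ≤ k → k ≤ j → b k = b' k) : IsArc b' i j := by
  induction h with
  | mk i j hij hi hj p hp hdown hup ihdown ihup =>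
    refine .mk i j hij ?_ ?_ p hp ?_ ?_
    · rw [← hb i le_rfl hij.le, hi]
    · rw [← hb j hij.le le_rfl, hj]
    · intro k h1 h2 hk
      rw [← hb k h1.le h2.le] at hk
      exact ihdown k h1 h2 hk fun x hx hx' => hb x (h1.le.trans hx) (hx'.trans (hp k h1 h2).2.le)
    · intro k h1 h2 hk
      rw [← hb k h1.le h2.le] at hk
      exact ihup k h1 h2 hk fun x hx hx' => hb x ((hp k h1 h2).1.le.trans hx) (hx'.trans h2.le)

theorem IsArc.not_lt_right {i j j' : Fin N} (h : IsArc b i j) (h' : IsArc b i j') : ¬ j < j' := by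
  induction j' using WellFoundedLT.induction generalizing i j with
  | ind j' ih =>
    intro hjj
    obtain ⟨l, hil, hl⟩ := h'.exists_left h.lt hjj h.right_eq
    obtain ⟨l', hl'j, hl'⟩ := h.exists_right hil hl.lt hl.left_eq
    exact ih j hjj hl' hl hl'j

theorem IsArc.right_unique {i j j' : Fin N} (h : IsArc b i j) (h' : IsArc b i j') : j = j' :=
  le_antisymm (not_lt.1 (h'.not_lt_right h)) (not_lt.1 (h.not_lt_right h'))

theorem IsArc.not_lt_left {i i' j : Fin N} (h : IsArc b i j) (h' : IsArc b i' j) : ¬ i < i' := by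
  intro hii
  obtain ⟨l, hl, hl'⟩ := h.exists_right hii h'.lt h'.left_eq
  exact hl'.not_lt_right h' hl

theorem IsArc.left_unique {i i' j : Fin N} (h : IsArc b i j) (h' : IsArc b i' j) : i = i' :=
  le_antisymm (not_lt.1 (h'.not_lt_left h)) (not_lt.1 (h.not_lt_left h'))

theorem IsArc.right_lt {i j k l : Fin N} (h : IsArc b i j) (h' : IsArc b k l) (hik : i < k)
    (hkj : k < j) : l < j := by
  obtain ⟨l', hl, hl'⟩ := h.exists_right hik hkj h'.left_eq
  rwa [h'.right_unique hl']

theorem IsArc.lt_left {i j k l : Fin N} (h : IsArc b i j) (h' : IsArc b k l) (hil : i < l)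
    (hlj : l < j) : i < k := by
  obtain ⟨k', hk, hk'⟩ := h.exists_left hil hlj h'.right_eq
  rwa [h'.left_unique hk']

/-- An arc meets the interval spanned by another arc in both of its ends or in none. -/
theorem IsArc.mem_interval_iff {i j k l : Fin N} (h : IsArc b i j) (h' : IsArc b k l) :
    (i ≤ k ∧ k ≤ j) ↔ (i ≤ l ∧ l ≤ j) := by
  constructor
  · rintro ⟨h1, h2⟩
    rcases h1.eq_or_lt with rfl | h1
    · rw [h'.right_unique h]; exact ⟨h.lt.le, le_rfl⟩
    rcases h2.eq_or_lt with rfl | h2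
    · simpa [h.right_eq] using h'.left_eq
    exact ⟨(h1.trans h'.lt).le, (h.right_lt h' h1 h2).le⟩
  · rintro ⟨h1, h2⟩
    rcases h2.eq_or_lt with rfl | h2
    · rw [h'.left_unique h]; exact ⟨le_rfl, h.lt.le⟩
    rcases h1.eq_or_lt with rfl | h1
    · simpa [h.left_eq] using h'.right_eq
    exact ⟨(h.lt_left h' h1 h2).le, (h'.lt.trans h2).le⟩

theorem IsUnpaired.not_between {i j k : Fin N} (hk : IsUnpaired b k) (h : IsArc b i j)
    (hik : i < k) : j < k := by
  by_contra hkj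
  rcases (not_lt.1 hkj).eq_or_lt with rfl | hkj
  · exact (hk i).2 h
  cases hb : b k
  · obtain ⟨l, -, hl⟩ := h.exists_right hik hkj hb
    exact (hk l).1 hl
  · obtain ⟨l, -, hl⟩ := h.exists_left hik hkj hb
    exact (hk l).2 hl

theorem exists_isArc_of_not_isUnpaired_of_false {i : Fin N} (hi : ¬ IsUnpaired b i)
    (hb : b i = false) : ∃ j, IsArc b i j := by
  simp only [IsUnpaired, not_forall, not_and_or, not_not] at hi
  obtain ⟨j, h | h⟩ := hi
  · exact ⟨j, h⟩
  · simp [h.right_eq] at hb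

theorem exists_isArc_of_not_isUnpaired_of_true {i : Fin N} (hi : ¬ IsUnpaired b i)
    (hb : b i = true) : ∃ j, IsArc b j i := by
  simp only [IsUnpaired, not_forall, not_and_or, not_not] at hi
  obtain ⟨j, h | h⟩ := hi
  · simp [h.left_eq] at hb
  · exact ⟨j, h⟩

theorem exists_partner_between {i j k : Fin N} (hi : IsUnpaired b i) (hj : IsUnpaired b j)
    (hik : i < k) (hkj : k < j) (hk : ¬ IsUnpaired b k) :
    ∃ l, i < l ∧ l < j ∧ (IsArc b k l ∨ IsArc b l k) := by
  cases hb : b k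
  · obtain ⟨l, hl⟩ := exists_isArc_of_not_isUnpaired_of_false hk hb
    exact ⟨l, hik.trans hl.lt, hj.not_between hl hkj, .inl hl⟩
  · obtain ⟨l, hl⟩ := exists_isArc_of_not_isUnpaired_of_true hk hb
    refine ⟨l, ?_, hl.lt.trans hkj, .inr hl⟩
    by_contra hli
    rcases (not_lt.1 hli).eq_or_lt with rfl | hli
    · exact (hi k).1 hl
    · exact hik.not_gt (hi.not_between hl hli)

theorem IsUnpaired.up_lt_down {i j : Fin N} (hi : IsUnpaired b i) (hbi : b i = false)
    (hj : IsUnpaired b j) (hbj : b j = true) : j < i := by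
  by_contra hij
  have hij : i < j := lt_of_le_of_ne (not_lt.1 hij) (by rintro rfl; simp [hbi] at hbj)
  induction hn : (j : ℕ) - i using Nat.strong_induction_on generalizing i j with
  | _ n ih =>
    subst hn
    by_cases h : ∃ k, i < k ∧ k < j ∧ IsUnpaired b k
    · obtain ⟨k, hik, hkj, hk⟩ := h
      cases hbk : b k
      · exact ih (j - k) (by omega) hk hbk hj hbj (not_lt.2 hkj.le) hkj rfl
      · exact ih (k - i) (by omega) hi hbi hk hbk (not_lt.2 hik.le) hik rfl
    · push Not at h
      exact (hi j).1 (isArc_of_forall_between hij hbi hbj fun k hik hkj =>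
        exists_partner_between hi hj hik hkj (h k hik hkj))

theorem mem_arcs {p : Fin N × Fin N} : p ∈ arcs b ↔ IsArc b p.1 p.2 := by simp [arcs]

theorem mem_upArrows {i : Fin N} : i ∈ upArrows b ↔ IsUnpaired b i ∧ b i = true := by
  simp [upArrows]

theorem mem_downArrows {i : Fin N} : i ∈ downArrows b ↔ IsUnpaired b i ∧ b i = false := by
  simp [downArrows]

/-- Every position is an unpaired arrow or an end of exactly one arc. -/
@[to_additive]
theorem prod_eq_prod_arcs_mul {M : Type*} [CommMonoid M] (b : Word N) (f : Fin N → M) :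
    ∏ i, f i = (∏ p ∈ arcs b, f p.1 * f p.2) * (∏ i ∈ upArrows b, f i) *
      ∏ i ∈ downArrows b, f i := by
  classical
  have h1 : (Finset.univ.filter fun i => ¬ IsUnpaired b i).filter (fun i => b i = false) =
      (arcs b).image Prod.fst := by
    ext i
    simp only [Finset.mem_filter, Finset.mem_univ, true_and, Finset.mem_image, mem_arcs,
      Prod.exists, exists_and_right, exists_eq_right]
    exact ⟨fun h => exists_isArc_of_not_isUnpaired_of_false h.1 h.2,
      fun ⟨j, h⟩ => ⟨fun hu => (hu j).1 h, h.left_eq⟩⟩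
  have h2 : (Finset.univ.filter fun i => ¬ IsUnpaired b i).filter (fun i => b i = true) =
      (arcs b).image Prod.snd := by
    ext i
    simp only [Finset.mem_filter, Finset.mem_univ, true_and, Finset.mem_image, mem_arcs,
      Prod.exists, exists_eq_right]
    exact ⟨fun h => exists_isArc_of_not_isUnpaired_of_true h.1 h.2,
      fun ⟨j, h⟩ => ⟨fun hu => (hu j).2 h, h.right_eq⟩⟩
  have h3 : ∏ p ∈ arcs b, f p.1 = ∏ i ∈ (arcs b).image Prod.fst, f i := by
    rw [Finset.prod_image]
    rintro ⟨i, j⟩ h ⟨i', j'⟩ h' (rfl : i = i')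
    simp only [Finset.mem_coe, mem_arcs] at h h'
    rw [h.right_unique h']
  have h4 : ∏ p ∈ arcs b, f p.2 = ∏ i ∈ (arcs b).image Prod.snd, f i := by
    rw [Finset.prod_image]
    rintro ⟨i, j⟩ h ⟨i', j'⟩ h' (rfl : j = j')
    simp only [Finset.mem_coe, mem_arcs] at h h'
    rw [h.left_unique h']
  have h5 : upArrows b = (Finset.univ.filter (IsUnpaired b)).filter (fun i => b i = true) := by
    ext i; simp [mem_upArrows]
  have h5' : downArrows b =
      (Finset.univ.filter (IsUnpaired b)).filter (fun i => b i = false) := by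
    ext i; simp [mem_downArrows]
  have h6 : ∀ s : Finset (Fin N), (∏ i ∈ s with b i = false, f i) * ∏ i ∈ s with b i = true, f i =
      ∏ i ∈ s, f i := fun s => by
    rw [← Finset.prod_filter_mul_prod_filter_not s (fun i => b i = false)]
    simp
  rw [Finset.prod_mul_distrib, h3, h4, ← h1, ← h2, h5, h5', h6, mul_assoc,
    mul_comm (∏ i ∈ _ with b i = true, f i), h6, mul_comm, Finset.prod_filter_mul_prod_filter_not]

end ArcCombinatorics

section Flip

variable {N : ℕ} {b : Word N}

theorem IsArc.flip_up {i k l : Fin N} (hi : i ∈ upArrows b) (h : IsArc b k l) :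
    IsArc (Function.update b i false) k l := by
  refine h.congr fun x hkx hxl => ?_
  rw [Function.update_of_ne]
  rintro rfl
  rw [mem_upArrows] at hi
  rcases hkx.eq_or_lt with rfl | hkx
  · exact (hi.1 l).1 h
  · exact hxl.not_gt (hi.1.not_between h hkx)

theorem isArc_or_of_flip_up {i k l : Fin N} (hi : i ∈ upArrows b)
    (h : IsArc (Function.update b i false) k l) : IsArc b k l ∨ (k = i ∧ l ∈ upArrows b) := by
  have hli : l ≠ i := by
    rintro rfl
    simpa using h.right_eq
  have hl : b l = true := by simpa [hli] using h.right_eq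
  by_cases hlu : IsUnpaired b l
  · right
    have hlm : l ∈ upArrows b := mem_upArrows.2 ⟨hlu, hl⟩
    refine ⟨?_, hlm⟩
    by_contra hki
    have hk : b k = false := by simpa [hki] using h.left_eq
    by_cases hku : IsUnpaired b k
    · exact h.lt.not_gt (hku.up_lt_down hk hlu hl)
    · obtain ⟨m, hm⟩ := exists_isArc_of_not_isUnpaired_of_false hku hk
      rw [(hm.flip_up hi).right_unique h] at hm
      exact (hlu k).2 hm
  · left
    obtain ⟨m, hm⟩ := exists_isArc_of_not_isUnpaired_of_true hlu hl
    rwa [(hm.flip_up hi).left_unique h] at hm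

/-- `j` is the unpaired up arrow following the unpaired up arrow `i`. -/
def IsNextUp (b : Word N) (i j : Fin N) : Prop :=
  i ∈ upArrows b ∧ j ∈ upArrows b ∧ i < j ∧ ∀ k ∈ upArrows b, i < k → j ≤ k

theorem IsNextUp.right_unique {i j j' : Fin N} (h : IsNextUp b i j) (h' : IsNextUp b i j') :
    j = j' :=
  le_antisymm (h.2.2.2 _ h'.2.1 h'.2.2.1) (h'.2.2.2 _ h.2.1 h.2.2.1)

theorem exists_isNextUp {i k : Fin N} (hi : i ∈ upArrows b) (hk : k ∈ upArrows b) (hik : i < k) :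
    ∃ j, IsNextUp b i j := by
  have hne : ((upArrows b).filter fun k => i < k).Nonempty :=
    ⟨k, Finset.mem_filter.2 ⟨hk, hik⟩⟩
  have h := Finset.min'_mem _ hne
  rw [Finset.mem_filter] at h
  exact ⟨_, hi, h.1, h.2, fun k hk hik => Finset.min'_le _ _ (Finset.mem_filter.2 ⟨hk, hik⟩)⟩

theorem IsNextUp.isArc_flip {i j : Fin N} (h : IsNextUp b i j) :
    IsArc (Function.update b i false) i j := by
  obtain ⟨hi, hj, hij, hn⟩ := h
  have hi' := mem_upArrows.1 hi
  have hj' := mem_upArrows.1 hj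
  refine isArc_of_forall_between hij (by simp) (by simp [hij.ne', hj'.2]) fun k hik hkj => ?_
  have hk : ¬ IsUnpaired b k := by
    intro hk
    cases hbk : b k
    · exact hkj.not_gt (hk.up_lt_down hbk hj'.1 hj'.2)
    · exact hkj.not_ge (hn k (mem_upArrows.2 ⟨hk, hbk⟩) hik)
  obtain ⟨l, h1, h2, h3⟩ := exists_partner_between hi'.1 hj'.1 hik hkj hk
  exact ⟨l, h1, h2, h3.imp (IsArc.flip_up hi) (IsArc.flip_up hi)⟩

theorem IsNextUp.isArc_flip_iff {i j k l : Fin N} (h : IsNextUp b i j) :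
    IsArc (Function.update b i false) k l ↔ (k = i ∧ l = j) ∨ IsArc b k l := by
  constructor
  · intro h'
    rcases isArc_or_of_flip_up h.1 h' with h'' | ⟨rfl, -⟩
    · exact .inr h''
    · exact .inl ⟨rfl, h'.right_unique h.isArc_flip⟩
  · rintro (⟨rfl, rfl⟩ | h')
    · exact h.isArc_flip
    · exact h'.flip_up h.1

theorem isArc_flip_last_iff {i k l : Fin N} (hi : i ∈ upArrows b) (h : ∀ k ∈ upArrows b, k ≤ i) :
    IsArc (Function.update b i false) k l ↔ IsArc b k l := by
  refine ⟨fun h' => ?_, fun h' => h'.flip_up hi⟩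
  rcases isArc_or_of_flip_up hi h' with h'' | ⟨rfl, hl⟩
  · exact h''
  · exact absurd (h l hl) h'.lt.not_ge

theorem IsNextUp.arcs_flip {i j : Fin N} (h : IsNextUp b i j) :
    arcs (Function.update b i false) = insert (i, j) (arcs b) := by
  ext ⟨k, l⟩
  simp [mem_arcs, h.isArc_flip_iff]

theorem IsNextUp.not_mem_arcs {i j : Fin N} (h : IsNextUp b i j) : (i, j) ∉ arcs b := fun h' =>
  ((mem_upArrows.1 h.1).1 j).1 (mem_arcs.1 h')

theorem IsNextUp.upArrows_flip {i j : Fin N} (h : IsNextUp b i j) :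
    upArrows (Function.update b i false) = ((upArrows b).erase i).erase j := by
  ext k
  simp only [mem_upArrows, IsUnpaired, h.isArc_flip_iff, Finset.mem_erase]
  by_cases hk : k = i
  · subst hk; simp
  · simp only [hk, false_and, false_or, not_or, not_and, ne_eq, not_false_eq_true,
      Function.update_of_ne, true_and]
    constructor
    · rintro ⟨h1, h2⟩
      exact ⟨fun hkj => (h1 i).2.1 rfl hkj, fun l => ⟨(h1 l).1, (h1 l).2.2⟩, h2⟩
    · rintro ⟨h1, h2, h3⟩
      exact ⟨fun l => ⟨(h2 l).1, fun _ => h1, (h2 l).2⟩, h3⟩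

theorem IsNextUp.downArrows_flip {i j : Fin N} (h : IsNextUp b i j) :
    downArrows (Function.update b i false) = downArrows b := by
  have hi := mem_upArrows.1 h.1
  have hj := mem_upArrows.1 h.2.1
  ext k
  simp only [mem_downArrows, IsUnpaired, h.isArc_flip_iff]
  by_cases hk : k = i
  · subst hk
    simp only [hi.2, Bool.true_eq_false, and_false, iff_false]
    rintro ⟨h1, -⟩
    simpa using (h1 j).1
  · simp only [hk, false_and, false_or, not_or, not_and, ne_eq, not_false_eq_true,
      Function.update_of_ne]
    constructor
    · rintro ⟨h1, h2⟩
      exact ⟨fun l => ⟨(h1 l).1, (h1 l).2.2⟩, h2⟩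
    · rintro ⟨h1, h2⟩
      refine ⟨fun l => ⟨(h1 l).1, ?_, (h1 l).2⟩, h2⟩
      rintro - rfl
      simp [hj.2] at h2

section Last

variable {i : Fin N} (hi : i ∈ upArrows b) (h : ∀ k ∈ upArrows b, k ≤ i)
include hi h

theorem arcs_flip_last : arcs (Function.update b i false) = arcs b := by
  ext ⟨k, l⟩
  simp [mem_arcs, isArc_flip_last_iff hi h]

theorem isUnpaired_flip_last_iff {k : Fin N} :
    IsUnpaired (Function.update b i false) k ↔ IsUnpaired b k := by
  simp only [IsUnpaired, isArc_flip_last_iff hi h]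

theorem upArrows_flip_last : upArrows (Function.update b i false) = (upArrows b).erase i := by
  ext k
  simp only [mem_upArrows, isUnpaired_flip_last_iff hi h, Finset.mem_erase]
  by_cases hk : k = i
  · subst hk; simp
  · simp [hk]

theorem downArrows_flip_last :
    downArrows (Function.update b i false) = insert i (downArrows b) := by
  have hi' := mem_upArrows.1 hi
  ext k
  simp only [mem_downArrows, isUnpaired_flip_last_iff hi h, Finset.mem_insert]
  by_cases hk : k = i
  · subst hk; simp [hi'.1]
  · simp [hk]

end Last

theorem not_mem_downArrows_of_mem_upArrows {i : Fin N} (hi : i ∈ upArrows b) :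
    i ∉ downArrows b := fun h => by
  have h1 := (mem_upArrows.1 hi).2
  simp [(mem_downArrows.1 h).2] at h1

end Flip

section Lowering

variable {K : Type*} [Field K] {N : ℕ} {b : Word N} {ε : Word N} {q : K}

/-- The number of `+` minus the number of `-` before position `i`. -/
def balance (ε : Word N) (i : Fin N) : ℤ :=
  ∑ k, if k < i then (if ε k = true then 1 else -1) else 0

theorem arcCoeff_eq_zero_of_eq {x y : Bool} (h : x = y) : arcCoeff q x y = 0 := by
  subst h; cases x <;> rfl

theorem balance_eq_card {i : Fin N} (hi : i ∈ upArrows b)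
    (harc : ∀ p ∈ arcs b, ε p.1 ≠ ε p.2) (hup : ∀ k ∈ upArrows b, k ≠ i → ε k = true) :
    balance ε i = ((upArrows b).filter fun k => k < i).card := by
  have hi' := mem_upArrows.1 hi
  rw [balance, sum_eq_sum_arcs_add b, Finset.sum_eq_zero (s := arcs b), Finset.sum_eq_zero
    (s := downArrows b), Finset.card_filter, add_zero, zero_add]
  · push_cast
    refine Finset.sum_congr rfl fun k hk => ?_
    split_ifs with h1 h2
    · rfl
    · exact absurd (hup k hk h1.ne) h2
    · rfl
  · intro k hk
    have hk' := mem_downArrows.1 hk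
    rw [if_neg (hk'.1.up_lt_down hk'.2 hi'.1 hi'.2).not_gt]
  · intro p hp
    have hp' := mem_arcs.1 hp
    have h1 : p.1 < i ↔ p.2 < i :=
      ⟨fun h => hi'.1.not_between hp' h, fun h => hp'.lt.trans h⟩
    have h2 := harc p hp
    simp only [h1]
    cases h3 : ε p.1 <;> cases h4 : ε p.2 <;> simp_all <;> split_ifs <;> simp

theorem balance_right_eq {i j : Fin N} (hij : IsArc b i j) (hi : ε i = false)
    (harc : ∀ p ∈ arcs b, p ≠ (i, j) → ε p.1 ≠ ε p.2) :
    balance ε j = balance ε i - 1 := by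
  have h1 : balance ε j - balance ε i =
      ∑ k, if i ≤ k ∧ k < j then (if ε k = true then 1 else -1) else 0 := by
    rw [balance, balance, ← Finset.sum_sub_distrib]
    refine Finset.sum_congr rfl fun k _ => ?_
    have := hij.lt
    by_cases h1 : k < i
    · simp [h1, h1.trans this, not_le.2 h1]
    · simp [h1, not_lt.1 h1]
  have h2 : ∀ k, IsUnpaired b k → ¬ (i ≤ k ∧ k < j) := by
    rintro k hk ⟨h1, h2⟩
    rcases h1.eq_or_lt with rfl | h1
    · exact (hk j).1 hij
    · exact h2.not_gt (hk.not_between hij h1)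
  rw [sum_eq_sum_arcs_add b, Finset.sum_eq_zero (s := upArrows b), Finset.sum_eq_zero
    (s := downArrows b), Finset.sum_eq_single (i, j)] at h1
  · simp only [le_refl, hij.lt, and_self, if_true, hi, lt_irrefl, and_false, if_false] at h1
    simp at h1
    linarith
  · intro p hp hne
    have hp' := mem_arcs.1 hp
    have h3 : (i ≤ p.1 ∧ p.1 < j) ↔ (i ≤ p.2 ∧ p.2 < j) := by
      have h4 := hij.mem_interval_iff hp'
      have h5 : p.1 ≠ j := by
        intro h; have := hp'.left_eq; rw [h, hij.right_eq] at this; simp at this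
      have h6 : p.2 ≠ j := by
        rintro h
        rw [h] at hp'
        exact hne (Prod.ext (hp'.left_unique hij) h)
      rw [lt_iff_le_and_ne, lt_iff_le_and_ne]
      tauto
    have h7 := harc p hp hne
    simp only [h3]
    cases h8 : ε p.1 <;> cases h9 : ε p.2 <;> simp_all <;> split_ifs <;> simp
  · intro h; exact absurd (mem_arcs.2 hij) h
  · intro k hk; rw [if_neg (h2 k (mem_downArrows.1 hk).1)]
  · intro k hk; rw [if_neg (h2 k (mem_upArrows.1 hk).1)]

/-- The contribution of position `i` to the lowering operator applied to `f`. -/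
def lowerAt (q : K) (f : State K N) (ε : Word N) (i : Fin N) : K :=
  if ε i = false then q ^ balance ε i * f (Function.update ε i true) else 0

/-- The lowering operator of `U_q(sl₂)` on the tensor product. -/
def lower (q : K) (f : State K N) (ε : Word N) : K := ∑ i, lowerAt q f ε i

theorem lowerAt_down {i : Fin N} (hi : i ∈ downArrows b) :
    lowerAt q (klVector q b) ε i = 0 := by
  rw [lowerAt, klVector, Finset.prod_eq_zero hi (by simp)]
  simp

theorem update_apply_of_unpaired_right {i : Fin N} (hi : IsUnpaired b i) {p : Fin N × Fin N}
    (hp : p ∈ arcs b) (x : Bool) :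
    Function.update ε i x p.1 = ε p.1 ∧ Function.update ε i x p.2 = ε p.2 := by
  have hp' := mem_arcs.1 hp
  constructor
  · rw [Function.update_of_ne]
    rintro rfl; exact (hi _).1 hp'
  · rw [Function.update_of_ne]
    rintro rfl; exact (hi _).2 hp'

/-- The product over the arcs and down arrows in `klVector`. -/
def arcDownCoeff (q : K) (b ε : Word N) : K :=
  (∏ p ∈ arcs b, arcCoeff q (ε p.1) (ε p.2)) *
    ∏ i ∈ downArrows b, if ε i = false then 1 else 0

open Classical in
/-- The indicator of `ε` having, among the unpaired up arrows of `b`, its only `-` at `i`. -/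
def onlyMinusAt (K : Type*) [Field K] (b ε : Word N) (i : Fin N) : K :=
  if ε i = false ∧ ∀ k ∈ upArrows b, k ≠ i → ε k = true then 1 else 0

theorem lowerAt_up {i : Fin N} (hi : i ∈ upArrows b) :
    lowerAt q (klVector q b) ε i = arcDownCoeff q b ε * (onlyMinusAt K b ε i *
      q ^ (((upArrows b).filter fun k => k < i).card)) := by
  have hi' := mem_upArrows.1 hi
  rw [lowerAt, onlyMinusAt]
  by_cases hε : ε i = false
  swap
  · simp [hε]
  rw [if_pos hε, klVector, Finset.prod_congr rfl fun p hp => by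
      rw [(update_apply_of_unpaired_right hi'.1 hp true).1,
        (update_apply_of_unpaired_right hi'.1 hp true).2],
    Finset.prod_congr (s₁ := downArrows b) (g := fun k => if ε k = false then 1 else 0) rfl
      fun k hk => by rw [Function.update_of_ne fun hki : k = i =>
        not_mem_downArrows_of_mem_upArrows hi (hki ▸ hk)]]
  by_cases hup : ∀ k ∈ upArrows b, k ≠ i → ε k = true
  · rw [Finset.prod_eq_one (s := upArrows b), if_pos ⟨hε, hup⟩, arcDownCoeff]
    · by_cases harc : ∀ p ∈ arcs b, ε p.1 ≠ ε p.2
      · rw [balance_eq_card hi harc hup, zpow_natCast]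
        ring
      · push Not at harc
        obtain ⟨p, hp, h⟩ := harc
        rw [Finset.prod_eq_zero hp (arcCoeff_eq_zero_of_eq h)]
        simp
    · intro k hk
      by_cases hki : k = i
      · subst hki; simp
      · simp [hki, hup k hk hki]
  · rw [if_neg (fun h => hup h.2)]
    push Not at hup
    obtain ⟨k, hk, hki, h⟩ := hup
    rw [Finset.prod_eq_zero hk (by simp [hki, h])]
    simp

theorem lowerAt_arc (hq : q ≠ 0) {i j : Fin N} (hij : IsArc b i j) :
    lowerAt q (klVector q b) ε i + lowerAt q (klVector q b) ε j = 0 := by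
  classical
  have hne := hij.lt.ne
  have hmem : (i, j) ∈ arcs b := mem_arcs.2 hij
  have hkl : ∀ k, k = i ∨ k = j → klVector q b (Function.update ε k true) =
      arcCoeff q (Function.update ε k true i) (Function.update ε k true j) *
      ((∏ p ∈ (arcs b).erase (i, j), arcCoeff q (ε p.1) (ε p.2)) *
        (∏ i ∈ upArrows b, if ε i = true then 1 else 0) *
        (∏ i ∈ downArrows b, if ε i = false then 1 else 0)) := by
    intro k hk
    have hu : ∀ x, IsUnpaired b x → Function.update ε k true x = ε x := by
      intro x hx
      rw [Function.update_of_ne]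
      rintro rfl
      rcases hk with rfl | rfl
      · exact (hx _).1 hij
      · exact (hx _).2 hij
    rw [klVector, ← Finset.mul_prod_erase _ _ hmem,
      Finset.prod_congr (s₁ := (arcs b).erase (i, j)) (g := fun p => arcCoeff q (ε p.1) (ε p.2))
        rfl,
      Finset.prod_congr (s₁ := upArrows b) (g := fun x => if ε x = true then 1 else 0) rfl,
      Finset.prod_congr (s₁ := downArrows b) (g := fun x => if ε x = false then 1 else 0) rfl]
    · ring
    · intro x hx; rw [hu x (mem_downArrows.1 hx).1]
    · intro x hx; rw [hu x (mem_upArrows.1 hx).1]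
    · rintro ⟨x, y⟩ hp
      rw [Finset.mem_erase, mem_arcs] at hp
      obtain ⟨hp1, hp2 : IsArc b x y⟩ := hp
      have hx : x ≠ k := by
        rintro rfl
        rcases hk with rfl | rfl
        · exact hp1 (by rw [hp2.right_unique hij])
        · have := hp2.left_eq; simp [hij.right_eq] at this
      have hy : y ≠ k := by
        rintro rfl
        rcases hk with rfl | rfl
        · have := hp2.right_eq; simp [hij.left_eq] at this
        · exact hp1 (by rw [hp2.left_unique hij])
      simp only [Function.update_of_ne hx, Function.update_of_ne hy]
  rw [lowerAt, lowerAt, hkl i (.inl rfl), hkl j (.inr rfl)]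
  simp only [Function.update_self, Function.update_of_ne hne, Function.update_of_ne hne.symm]
  cases hi : ε i <;> cases hj : ε j <;> simp [arcCoeff]
  by_cases harc : ∀ p ∈ arcs b, p ≠ (i, j) → ε p.1 ≠ ε p.2
  · rw [balance_right_eq hij hi harc, zpow_sub_one₀ hq]
    ring
  · push Not at harc
    obtain ⟨p, hp, hp', h⟩ := harc
    rw [Finset.prod_eq_zero (Finset.mem_erase.2 ⟨hp', hp⟩) (arcCoeff_eq_zero_of_eq h)]
    simp

theorem lower_klVector_eq (hq : q ≠ 0) : lower q (klVector q b) ε =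
    arcDownCoeff q b ε * ∑ i ∈ upArrows b, onlyMinusAt K b ε i *
      q ^ (((upArrows b).filter fun k => k < i).card) := by
  rw [lower, sum_eq_sum_arcs_add b, Finset.sum_eq_zero (s := arcs b) fun p hp =>
      lowerAt_arc hq (mem_arcs.1 hp), Finset.sum_eq_zero (s := downArrows b) fun i hi =>
      lowerAt_down hi, zero_add, add_zero, Finset.mul_sum]
  exact Finset.sum_congr rfl fun i hi => lowerAt_up hi

open Classical in
theorem klVector_flip {i : Fin N} (hi : i ∈ upArrows b) :
    klVector q (Function.update b i false) ε = arcDownCoeff q b ε * (onlyMinusAt K b ε i -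
      q⁻¹ * ∑ j ∈ upArrows b, if IsNextUp b i j then onlyMinusAt K b ε j else 0) := by
  by_cases hn : ∃ j, IsNextUp b i j
  · obtain ⟨j, hj⟩ := hn
    rw [Finset.sum_eq_single_of_mem j hj.2.1, if_pos hj, klVector, hj.arcs_flip,
      hj.upArrows_flip, hj.downArrows_flip, Finset.prod_insert hj.not_mem_arcs, arcDownCoeff]
    · by_cases hup : ∀ k ∈ ((upArrows b).erase i).erase j, ε k = true
      · rw [Finset.prod_eq_one (s := ((upArrows b).erase i).erase j)
          fun k hk => if_pos (hup k hk), mul_one]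
        have h1 : onlyMinusAt K b ε i = if ε i = false ∧ ε j = true then 1 else 0 := by
          rw [onlyMinusAt]
          congr 1
          simp only [eq_iff_iff, and_congr_right_iff]
          refine fun _ => ⟨fun h => h j hj.2.1 hj.2.2.1.ne', fun h k hk hki => ?_⟩
          by_cases hkj : k = j
          · rwa [hkj]
          · exact hup k (by simp [hkj, hki, hk])
        have h2 : onlyMinusAt K b ε j = if ε j = false ∧ ε i = true then 1 else 0 := by
          rw [onlyMinusAt]
          congr 1
          simp only [eq_iff_iff, and_congr_right_iff]
          refine fun _ => ⟨fun h => h i hi hj.2.2.1.ne, fun h k hk hkj => ?_⟩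
          by_cases hki : k = i
          · rwa [hki]
          · exact hup k (by simp [hkj, hki, hk])
        rw [h1, h2]
        cases ε i <;> cases ε j <;> simp [arcCoeff]; ring
      · push Not at hup
        obtain ⟨k, hk, h⟩ := hup
        rw [Finset.prod_eq_zero hk (if_neg h)]
        simp only [Finset.mem_erase] at hk
        rw [onlyMinusAt, onlyMinusAt, if_neg fun h' => h (h'.2 k hk.2.2 hk.2.1),
          if_neg fun h' => h (h'.2 k hk.2.2 hk.1)]
        simp
    · intro k _ hkj
      exact if_neg fun h => hkj (h.right_unique hj)
  · have hlast : ∀ k ∈ upArrows b, k ≤ i := fun k hk => by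
      by_contra h
      exact hn (exists_isNextUp hi hk (not_le.1 h))
    rw [Finset.sum_eq_zero fun j _ => if_neg fun h => hn ⟨j, h⟩, klVector,
      arcs_flip_last hi hlast, upArrows_flip_last hi hlast, downArrows_flip_last hi hlast,
      Finset.prod_insert (not_mem_downArrows_of_mem_upArrows hi), arcDownCoeff, onlyMinusAt]
    have : (∏ k ∈ (upArrows b).erase i, if ε k = true then (1 : K) else 0) =
        if ∀ k ∈ upArrows b, k ≠ i → ε k = true then 1 else 0 := by
      rw [Finset.prod_ite_zero]
      simp only [Finset.prod_const_one, Finset.mem_erase]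
      congr 1
      simp only [eq_iff_iff]
      tauto
    rw [this, ite_and]
    split_ifs <;> simp

end Lowering

section QuantumInt

variable {K : Type*} [Field K] {q : K}

@[simp] theorem quantumInt_zero : quantumInt q 0 = 0 := by simp [quantumInt]

theorem quantumInt_succ (hq : q ≠ 0) (m : ℕ) :
    quantumInt q (m + 1) = q ^ m + q⁻¹ * quantumInt q m := by
  rw [quantumInt, Finset.sum_range_succ', quantumInt, Finset.mul_sum, add_comm]
  congr 1
  · rw [← zpow_natCast]; congr 1; push_cast; ring
  · refine Finset.sum_congr rfl fun i _ => ?_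
    rw [← zpow_neg_one, ← zpow_add₀ hq]
    congr 1; push_cast; ring

theorem quantumInt_succ' (hq : q ≠ 0) (m : ℕ) :
    quantumInt q (m + 1) = q * quantumInt q m + q⁻¹ ^ m := by
  rw [quantumInt, Finset.sum_range_succ, quantumInt, Finset.mul_sum]
  congr 1
  · refine Finset.sum_congr rfl fun i _ => ?_
    rw [← zpow_one_add₀ hq]
    congr 1; push_cast; ring
  · rw [inv_pow, ← zpow_natCast, ← zpow_neg]; congr 1; push_cast; ring

theorem quantumInt_add (hq : q ≠ 0) (a b : ℕ) :
    quantumInt q (a + b) = q ^ b * quantumInt q a + q⁻¹ ^ a * quantumInt q b := by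
  induction b with
  | zero => simp
  | succ b ih =>
    rw [← add_assoc, quantumInt_succ' hq, ih, quantumInt_succ' hq]
    ring

theorem quantumInt_mul_sub (hq : q ≠ 0) (a m u : ℕ) :
    quantumInt q (a + m) * quantumInt q (u + a) -
      quantumInt q a * quantumInt q (u + a + m) = quantumInt q m * quantumInt q u := by
  have h1 := quantumInt_add hq a m
  have h2 := quantumInt_add hq (a + u) m
  have h3 := quantumInt_add hq a u
  have h4 := quantumInt_add hq u a
  rw [add_comm u a] at *
  have h5 : q⁻¹ ^ a * quantumInt q (a + u) - q⁻¹ ^ (a + u) * quantumInt q a = quantumInt q u := by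
    rw [h4]
    have : q⁻¹ ^ a * q ^ a = 1 := by rw [← mul_pow, inv_mul_cancel₀ hq, one_pow]
    linear_combination quantumInt q u * this
  rw [h1, h2]
  linear_combination quantumInt q m * h5

end QuantumInt

section Lowering

variable {K : Type*} [Field K] {N : ℕ} {b : Word N} {ε : Word N} {q : K}

theorem card_filter_le_eq_succ {s : Finset (Fin N)} {i : Fin N} (hi : i ∈ s) :
    (s.filter fun k => k ≤ i).card = (s.filter fun k => k < i).card + 1 := by
  have : s.filter (fun k => k ≤ i) = insert i (s.filter fun k => k < i) := by
    ext k
    simp only [Finset.mem_filter, Finset.mem_insert, le_iff_eq_or_lt]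
    constructor
    · tauto
    · rintro (rfl | h)
      · exact ⟨hi, .inl rfl⟩
      · exact ⟨h.1, .inr h.2⟩
  rw [this, Finset.card_insert_of_notMem (by simp)]

theorem IsNextUp.filter_le_eq {i j : Fin N} (h : IsNextUp b i j) :
    ((upArrows b).filter fun k => k ≤ i) = (upArrows b).filter fun k => k < j := by
  ext k
  simp only [Finset.mem_filter, and_congr_right_iff]
  intro hk
  refine ⟨fun h' => h'.trans_lt h.2.2.1, fun h' => ?_⟩
  by_contra h''
  exact h'.not_ge (h.2.2.2 k hk (not_le.1 h''))

theorem exists_isNextUp_left {j k : Fin N} (hj : j ∈ upArrows b) (hk : k ∈ upArrows b)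
    (hkj : k < j) : ∃ i, IsNextUp b i j := by
  have hne : ((upArrows b).filter fun k => k < j).Nonempty :=
    ⟨k, Finset.mem_filter.2 ⟨hk, hkj⟩⟩
  obtain ⟨m, hm, hmax⟩ : ∃ m ∈ (upArrows b).filter fun k => k < j,
      ∀ l ∈ (upArrows b).filter fun k => k < j, l ≤ m :=
    ⟨_, Finset.max'_mem _ hne, fun l => Finset.le_max' _ l⟩
  rw [Finset.mem_filter] at hm
  refine ⟨m, hm.1, hj, hm.2, fun l hl hml => ?_⟩
  by_contra hlj
  exact hml.not_ge (hmax l (Finset.mem_filter.2 ⟨hl, not_le.1 hlj⟩))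

theorem IsNextUp.left_unique {i i' j : Fin N} (h : IsNextUp b i j) (h' : IsNextUp b i' j) :
    i = i' := by
  by_contra hne
  rcases lt_or_gt_of_ne hne with hlt | hlt
  · exact (h.2.2.2 _ h'.1 hlt).not_gt h'.2.2.1
  · exact (h'.2.2.2 _ h.1 hlt).not_gt h.2.2.1

open Classical in
theorem sum_isNextUp_quantumInt {j : Fin N} (hj : j ∈ upArrows b) :
    (∑ i ∈ upArrows b, if IsNextUp b i j then
      quantumInt q ((upArrows b).filter fun k => k ≤ i).card else 0) =
      quantumInt q ((upArrows b).filter fun k => k < j).card := by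
  by_cases h : ∃ i, IsNextUp b i j
  · obtain ⟨i, hi⟩ := h
    rw [Finset.sum_eq_single_of_mem i hi.1, if_pos hi, hi.filter_le_eq]
    intro k _ hki
    exact if_neg fun h => hki (h.left_unique hi)
  · have : ((upArrows b).filter fun k => k < j) = ∅ := by
      rw [Finset.filter_eq_empty_iff]
      exact fun k hk hkj => h (exists_isNextUp_left hj hk hkj)
    rw [this, Finset.sum_eq_zero fun i _ => if_neg fun hi => h ⟨i, hi⟩]
    simp

/-- The action of the lowering operator on the Kazhdan--Lusztig basis. -/
theorem lower_klVector (hq : q ≠ 0) : lower q (klVector q b) ε =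
    ∑ i ∈ upArrows b, quantumInt q ((upArrows b).filter fun k => k ≤ i).card *
      klVector q (Function.update b i false) ε := by
  classical
  have h0 : ∑ i ∈ upArrows b, quantumInt q ((upArrows b).filter fun k => k ≤ i).card *
      klVector q (Function.update b i false) ε =
      ∑ i ∈ upArrows b, arcDownCoeff q b ε *
        (quantumInt q ((upArrows b).filter fun k => k ≤ i).card * onlyMinusAt K b ε i -
          quantumInt q ((upArrows b).filter fun k => k ≤ i).card *
      (q⁻¹ * ∑ j ∈ upArrows b, if IsNextUp b i j then onlyMinusAt K b ε j else 0)) :=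
    Finset.sum_congr rfl fun i hi => by rw [klVector_flip hi]; ring
  rw [lower_klVector_eq hq, h0, ← Finset.mul_sum, Finset.sum_sub_distrib]
  congr 1
  have h1 : ∑ i ∈ upArrows b, quantumInt q ((upArrows b).filter fun k => k ≤ i).card *
      (q⁻¹ * ∑ j ∈ upArrows b, if IsNextUp b i j then onlyMinusAt K b ε j else 0) =
      ∑ j ∈ upArrows b, onlyMinusAt K b ε j * (q⁻¹ *
        quantumInt q ((upArrows b).filter fun k => k < j).card) := by
    simp_rw [Finset.mul_sum]
    rw [Finset.sum_comm]
    refine Finset.sum_congr rfl fun j hj => ?_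
    rw [← sum_isNextUp_quantumInt hj, Finset.mul_sum, Finset.mul_sum]
    refine Finset.sum_congr rfl fun i _ => ?_
    split_ifs <;> ring
  rw [h1, ← Finset.sum_sub_distrib]
  refine Finset.sum_congr rfl fun i hi => ?_
  rw [card_filter_le_eq_succ hi, quantumInt_succ hq]
  ring

end Lowering

section ProductState

variable {K : Type*} [Field K] {N : ℕ} {ε : Word N} {q Q : K}

/-- The coordinate of the factor at site `i` of the product state. -/
def siteCoeff (N : ℕ) (q Q : K) (i : Fin N) (x : Bool) : K :=
  if x = true then Q * q ^ (N - 1 - (i : ℕ)) else 1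

/-- The product state `⨂_i (q^{N - i} Q v₁ + v₋₁)`. -/
def productState (N : ℕ) (q Q : K) : State K N := fun ε => ∏ i, siteCoeff N q Q i (ε i)

/-- The number of `-` in a word. -/
def minusCount (ε : Word N) : ℕ := (Finset.univ.filter fun k => ε k = false).card

theorem sum_card_filter_lt {M : Type*} [AddCommMonoid M] (f : ℕ → M) (s : Finset (Fin N)) :
    ∑ i ∈ s, f (s.filter fun k => k < i).card = ∑ j ∈ Finset.range s.card, f j := by
  induction s using Finset.induction_on_max with
  | empty => simp
  | insert a s hs ih =>
    have ha : a ∉ s := fun h => (hs a h).false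
    rw [Finset.sum_insert ha, Finset.card_insert_of_notMem ha, Finset.sum_range_succ, add_comm,
      ← ih]
    congr 1
    · refine Finset.sum_congr rfl fun i hi => ?_
      rw [Finset.filter_insert, if_neg (hs i hi).not_gt]
    · rw [Finset.filter_insert, if_neg (lt_irrefl a), Finset.filter_true_of_mem hs]

theorem balance_eq (ε : Word N) (i : Fin N) : balance ε i =
    i - 2 * ((Finset.univ.filter fun k => ε k = false).filter fun k => k < i).card := by
  have h : ((i : ℕ) : ℤ) = ∑ k : Fin N, if k < i then 1 else 0 := by
    have : (Finset.univ.filter fun k => k < i) = Finset.Iio i := by ext; simp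
    rw [Finset.sum_boole, this, Fin.card_Iio]
  rw [h, Finset.filter_filter, Finset.card_filter, balance]
  push_cast
  rw [Finset.mul_sum, ← Finset.sum_sub_distrib]
  refine Finset.sum_congr rfl fun k _ => ?_
  cases ε k <;> by_cases h : k < i <;> simp [h]

theorem productState_update {i : Fin N} (hi : ε i = false) :
    productState N q Q (Function.update ε i true) =
      Q * q ^ (N - 1 - (i : ℕ)) * productState N q Q ε := by
  rw [productState, productState, ← Finset.mul_prod_erase _ _ (Finset.mem_univ i),
    ← Finset.mul_prod_erase (a := i) _ (fun i => siteCoeff N q Q i (ε i)) (Finset.mem_univ i)]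
  simp only [Function.update_self, hi, siteCoeff, if_true, Bool.false_eq_true, if_false, one_mul]
  congr 1
  refine Finset.prod_congr rfl fun k hk => ?_
  rw [Function.update_of_ne (Finset.ne_of_mem_erase hk)]

theorem minusCount_le (ε : Word N) : minusCount ε ≤ N := by
  simpa [minusCount] using Finset.card_filter_le Finset.univ fun k => ε k = false

theorem lower_productState (hq : q ≠ 0) : lower q (productState N q Q) ε =
    Q * q ^ (N - minusCount ε) * quantumInt q (minusCount ε) * productState N q Q ε := by
  have h1 : lower q (productState N q Q) ε = ∑ i ∈ Finset.univ.filter fun k => ε k = false,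
      Q * productState N q Q ε * q ^ ((N : ℤ) - 1 -
        2 * (((Finset.univ.filter fun k => ε k = false).filter fun k => k < i).card : ℕ)) := by
    rw [lower, Finset.sum_filter]
    refine Finset.sum_congr rfl fun i _ => ?_
    rw [lowerAt]
    split_ifs with h
    · rw [productState_update h, balance_eq]
      have h2 : (N : ℤ) - 1 = (i : ℕ) + ((N - 1 - (i : ℕ) : ℕ) : ℤ) := by
        have := i.isLt; omega
      rw [h2, ← zpow_natCast q (N - 1 - (i : ℕ)), add_sub_right_comm, zpow_add₀ hq]
      ring
    · rfl
  rw [h1, sum_card_filter_lt fun j => Q * productState N q Q ε * q ^ ((N : ℤ) - 1 - 2 * (j : ℕ)),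
    ← Finset.mul_sum, quantumInt, ← minusCount, mul_assoc Q, Finset.mul_sum]
  have h3 : ∀ j : ℕ, q ^ ((N : ℤ) - 1 - 2 * j) =
      q ^ (N - minusCount ε) * q ^ ((minusCount ε : ℤ) - 1 - 2 * j) := by
    intro j
    rw [← zpow_natCast, ← zpow_add₀ hq, Nat.cast_sub (minusCount_le ε)]
    congr 1; ring
  simp_rw [h3, ← Finset.mul_sum]
  ring

end ProductState

section Counting

variable {N : ℕ} {b : Word N}

/-- The number of unpaired up arrows at the first `x` positions. -/
def upCount (b : Word N) (x : ℕ) : ℕ := ∑ k ∈ upArrows b, if (k : ℕ) < x then 1 else 0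

/-- The number of down arrows, paired or not, at the first `x` positions. -/
def downCount (b : Word N) (x : ℕ) : ℕ := ∑ k, if b k = false ∧ (k : ℕ) < x then 1 else 0

theorem sum_false_eq {M : Type*} [AddCommMonoid M] (f : Fin N → M) :
    (∑ k, if b k = false then f k else 0) = ∑ p ∈ arcs b, f p.1 + ∑ k ∈ downArrows b, f k := by
  rw [sum_eq_sum_arcs_add b, Finset.sum_eq_zero (s := upArrows b), add_zero]
  · congr 1
    · refine Finset.sum_congr rfl fun p hp => ?_
      rw [mem_arcs] at hp
      simp [hp.left_eq, hp.right_eq]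
    · exact Finset.sum_congr rfl fun k hk => if_pos (mem_downArrows.1 hk).2
  · intro k hk
    simp [(mem_upArrows.1 hk).2]

theorem prod_false_eq {M : Type*} [CommMonoid M] (f : Fin N → M) :
    (∏ k, if b k = false then f k else 1) = (∏ p ∈ arcs b, f p.1) * ∏ k ∈ downArrows b, f k :=
  sum_false_eq (M := Additive M) f

theorem downCount_eq (b : Word N) (x : ℕ) : downCount b x =
    (∑ p ∈ arcs b, if (p.1 : ℕ) < x then 1 else 0) +
      ∑ k ∈ downArrows b, if (k : ℕ) < x then 1 else 0 := by
  rw [← sum_false_eq (fun k : Fin N => if (k : ℕ) < x then 1 else 0), downCount]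
  refine Finset.sum_congr rfl fun k _ => ?_
  rw [ite_and]

theorem leftLabel_eq_sum (b : Word N) (i : Fin N) : leftLabel b i =
    (∑ k ∈ upArrows b, if k ≤ i then 1 else 0) + (∑ k ∈ downArrows b, if k ≤ i then 1 else 0) +
      ∑ p ∈ arcs b, if p.1 ≤ i then 1 else 0 := by
  simp only [leftLabel, Finset.card_filter]

theorem rightLabel_eq_sum (b : Word N) (i : Fin N) : rightLabel b i =
    (∑ k ∈ downArrows b, if i ≤ k then 1 else 0) + ∑ p ∈ arcs b, if i ≤ p.2 then 1 else 0 := by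
  simp only [rightLabel, Finset.card_filter]

theorem leftLabel_eq (b : Word N) (i : Fin N) :
    leftLabel b i = upCount b (i + 1) + downCount b (i + 1) := by
  rw [leftLabel_eq_sum, downCount_eq, upCount]
  simp only [Nat.lt_succ_iff, Fin.val_fin_le]
  ring

@[simp] theorem upCount_zero (b : Word N) : upCount b 0 = 0 := by simp [upCount]

@[simp] theorem downCount_zero (b : Word N) : downCount b 0 = 0 := by simp [downCount]

theorem upCount_eq_sum_univ (b : Word N) (x : ℕ) :
    upCount b x = ∑ k : Fin N, if k ∈ upArrows b ∧ (k : ℕ) < x then 1 else 0 := by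
  simp only [upCount, ite_and, Finset.sum_ite_mem, Finset.univ_inter]

theorem sum_ite_lt_succ (P : Fin N → Prop) [DecidablePred P] (i : Fin N) :
    (∑ k : Fin N, if P k ∧ (k : ℕ) < i + 1 then 1 else 0) =
      (∑ k : Fin N, if P k ∧ (k : ℕ) < i then 1 else 0) + if P i then 1 else 0 := by
  have h : (if P i then 1 else 0) = ∑ k, if k = i then (if P k then 1 else 0) else 0 := by simp
  rw [h, ← Finset.sum_add_distrib]
  refine Finset.sum_congr rfl fun k _ => ?_
  rcases lt_trichotomy k i with h | rfl | h
  · have h' : (k : ℕ) < i := h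
    simp [h.ne, h', h'.trans (Nat.lt_succ_self _)]
  · simp
  · have h' : (i : ℕ) < k := h
    simp [h.ne', not_lt.2 h'.le, not_lt.2 (Nat.succ_le_of_lt h')]

theorem downCount_succ (b : Word N) (i : Fin N) :
    downCount b (i + 1) = downCount b i + if b i = false then 1 else 0 :=
  sum_ite_lt_succ (fun k => b k = false) i

theorem upCount_succ (b : Word N) (i : Fin N) :
    upCount b (i + 1) = upCount b i + if i ∈ upArrows b then 1 else 0 := by
  rw [upCount_eq_sum_univ, upCount_eq_sum_univ]
  exact sum_ite_lt_succ (fun k => k ∈ upArrows b) i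

theorem upCount_add_downCount_le (b : Word N) {x : ℕ} (hx : x ≤ N) :
    upCount b x + downCount b x ≤ x := by
  induction x with
  | zero => simp
  | succ x ih =>
    have h1 := upCount_succ b ⟨x, hx⟩
    have h2 := downCount_succ b ⟨x, hx⟩
    have h3 := ih (Nat.le_of_succ_le hx)
    simp only at h1 h2
    rw [h1, h2]
    by_cases h4 : (⟨x, hx⟩ : Fin N) ∈ upArrows b
    · simp only [h4, (mem_upArrows.1 h4).2]
      simp; omega
    · simp only [h4, if_false]
      split_ifs <;> omega

theorem leftLabel_le (b : Word N) (i : Fin N) : leftLabel b i ≤ N := by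
  rw [leftLabel_eq]
  exact (upCount_add_downCount_le b i.isLt).trans i.isLt

theorem leftLabel_eq_of_false {i : Fin N} (hi : b i = false) :
    leftLabel b i = upCount b i + downCount b i + 1 := by
  have : i ∉ upArrows b := fun h => by simp [(mem_upArrows.1 h).2] at hi
  rw [leftLabel_eq, upCount_succ, downCount_succ, if_pos hi, if_neg this]
  ring

theorem downCount_eq_minusCount (b : Word N) : downCount b N = minusCount b := by
  simp [downCount, minusCount]

theorem downCount_sub_of_isArc {i j : Fin N} (h : IsArc b i j) :
    downCount b (j + 1) = downCount b i + ((j : ℕ) - (i : ℕ) + 1) / 2 := by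
  have hij : (i : ℕ) < j := h.lt
  have h1 : ∑ k : Fin N, (if i ≤ k ∧ k ≤ j then (if b k = false then (1 : ℤ) else -1) else 0)
      = 0 := by
    rw [sum_eq_sum_arcs_add b, Finset.sum_eq_zero (s := upArrows b), Finset.sum_eq_zero
      (s := downArrows b), Finset.sum_eq_zero (s := arcs b)]
    · simp
    · intro p hp
      have hp' := mem_arcs.1 hp
      simp only [h.mem_interval_iff hp', hp'.left_eq, hp'.right_eq]
      split_ifs <;> simp_all
    all_goals
      intro k hk
      have hk : IsUnpaired b k := by
        first
          | exact (mem_upArrows.1 hk).1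
          | exact (mem_downArrows.1 hk).1
      rw [if_neg]
      rintro ⟨h1, h2⟩
      rcases h1.eq_or_lt with rfl | h1
      · exact (hk j).1 h
      · exact h2.not_gt (hk.not_between h h1)
  have h2 : ∑ k : Fin N, (if i ≤ k ∧ k ≤ j then (1 : ℤ) else 0) = (j : ℕ) - (i : ℕ) + 1 := by
    have : (Finset.univ.filter fun k => i ≤ k ∧ k ≤ j) = Finset.Icc i j := by ext; simp
    rw [Finset.sum_boole, this, Fin.card_Icc]
    push_cast [Nat.cast_sub (show (i : ℕ) ≤ j + 1 by omega)]
    ring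
  have h3 : (2 : ℤ) * downCount b (j + 1) - 2 * downCount b i = (j : ℕ) - (i : ℕ) + 1 := by
    rw [← h2]
    refine Eq.trans ?_ ((congrArg (_ + ·) h1).trans (add_zero _))
    rw [downCount, downCount]
    push_cast
    rw [← mul_sub, ← Finset.sum_sub_distrib, Finset.mul_sum, ← Finset.sum_add_distrib]
    refine Finset.sum_congr rfl fun k _ => ?_
    have e1 : (k : ℕ) < j + 1 ↔ k ≤ j := by rw [Nat.lt_succ_iff]; rfl
    have e2 : (k : ℕ) < i ↔ ¬ i ≤ k := by rw [not_le]; rfl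
    have e3 : ¬ i ≤ k → k ≤ j := fun h' => (not_le.1 h').le.trans h.lt.le
    simp only [e1, e2]
    by_cases c1 : i ≤ k
    · by_cases c2 : k ≤ j <;> cases b k <;> simp [c1, c2]
    · cases b k <;> simp [c1, e3 c1]
  omega

end Counting

section Boundary

variable {N : ℕ} {b : Word N}

/-- The cut before position `x` crosses no arc, and no unpaired down arrow precedes it. -/
def IsBoundary (b : Word N) (x : ℕ) : Prop :=
  (∀ k l, IsArc b k l → (k : ℕ) < x → (l : ℕ) < x) ∧ ∀ k ∈ downArrows b, x ≤ (k : ℕ)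

theorem isBoundary_flip {i : Fin N} (hi : i ∈ upArrows b) :
    IsBoundary (Function.update b i false) i := by
  have hi' := mem_upArrows.1 hi
  constructor
  · intro k l hkl hki
    rcases isArc_or_of_flip_up hi hkl with h | ⟨rfl, -⟩
    · exact hi'.1.not_between h hki
    · exact absurd hki (lt_irrefl _)
  · have hd : ∀ k ∈ downArrows b, (i : ℕ) ≤ k := fun k hk =>
      ((mem_downArrows.1 hk).1.up_lt_down (mem_downArrows.1 hk).2 hi'.1 hi'.2).le
    by_cases hn : ∃ j, IsNextUp b i j
    · obtain ⟨j, hj⟩ := hn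
      rwa [hj.downArrows_flip]
    · rw [downArrows_flip_last hi fun k hk => not_lt.1 fun h => hn (exists_isNextUp hi hk h)]
      intro k hk
      rcases Finset.mem_insert.1 hk with rfl | hk
      · rfl
      · exact hd k hk

theorem mem_upArrows_update_of_isBoundary {i : Fin N} (hb : IsBoundary b i) :
    i ∈ upArrows (Function.update b i true) := by
  refine mem_upArrows.2 ⟨fun k => ⟨fun h => ?_, fun h => ?_⟩, by simp⟩
  · simpa using h.left_eq
  · have hki : k < i := h.lt
    have hk : b k = false := by simpa [hki.ne] using h.left_eq
    by_cases hku : IsUnpaired b k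
    · exact absurd (hb.2 k (mem_downArrows.2 ⟨hku, hk⟩)) (not_le.2 hki)
    · obtain ⟨l, hl⟩ := exists_isArc_of_not_isUnpaired_of_false hku hk
      have hli : l < i := hb.1 k l hl hki
      have hl' : IsArc (Function.update b i true) k l := hl.congr fun x _ hx => by
        rw [Function.update_of_ne (hx.trans_lt hli).ne]
      exact hli.ne (hl'.right_unique h)

theorem mem_upArrows_update_iff {i : Fin N} (hi : b i = false) :
    i ∈ upArrows (Function.update b i true) ↔ IsBoundary b i := by
  refine ⟨fun h => ?_, mem_upArrows_update_of_isBoundary⟩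
  have := isBoundary_flip h
  rwa [Function.update_idem, ← hi, Function.update_eq_self] at this

end Boundary

section FlipCoeff

variable {K : Type*} [Field K] {N : ℕ} {b : Word N} {q : K}

/-- The part of the coefficient of `|D⟩` in `Ψ` that is made of quantum integers. -/
def labelCoeff (q : K) (b : Word N) : K := psiN2 q b * psiN3 q b * psiN4 q b

/-- The effect on the product of left labels of raising by one the labels of the down arrows
at positions `≥ x`. -/
def labelShift (q : K) (b : Word N) (x : ℕ) : K :=
  ∏ k, if b k = false then
    (if x ≤ (k : ℕ) then quantumInt q (leftLabel b k + 1) / quantumInt q (leftLabel b k) else 1)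
  else 1

theorem leftLabel_flip_next {i j : Fin N} (h : IsNextUp b i j) (k : Fin N) :
    leftLabel b k = leftLabel (Function.update b i false) k + if j ≤ k then 1 else 0 := by
  rw [leftLabel_eq_sum, leftLabel_eq_sum, h.arcs_flip, h.upArrows_flip, h.downArrows_flip,
    Finset.sum_insert h.not_mem_arcs, ← Finset.add_sum_erase _ _ h.1,
    ← Finset.add_sum_erase _ _ (Finset.mem_erase.2 ⟨h.2.2.1.ne', h.2.1⟩)]
  ring

theorem leftLabel_flip_last {i : Fin N} (hi : i ∈ upArrows b) (h : ∀ k ∈ upArrows b, k ≤ i)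
    (k : Fin N) : leftLabel b k = leftLabel (Function.update b i false) k := by
  rw [leftLabel_eq_sum, leftLabel_eq_sum, arcs_flip_last hi h, upArrows_flip_last hi h,
    downArrows_flip_last hi h, Finset.sum_insert (not_mem_downArrows_of_mem_upArrows hi),
    ← Finset.add_sum_erase _ _ hi]
  ring

theorem one_le_leftLabel {i : Fin N} (hi : b i = false) : 1 ≤ leftLabel b i := by
  rw [leftLabel_eq_of_false hi]; omega

theorem labelCoeff_flip_next (hgen : ∀ m, 1 ≤ m → m ≤ N → quantumInt q m ≠ 0) {i j : Fin N}
    (h : IsNextUp b i j) :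
    labelCoeff q b * quantumInt q (leftLabel (Function.update b i false) i) =
      labelCoeff q (Function.update b i false) *
        quantumInt q (((j : ℕ) - (i : ℕ) + 1) / 2) *
        labelShift q (Function.update b i false) (j + 1) := by
  have hi' := mem_upArrows.1 h.1
  have hj' := mem_upArrows.1 h.2.1
  have hij : (i : ℕ) < j := h.2.2.1
  have hm : quantumInt q (((j : ℕ) - (i : ℕ) + 1) / 2) ≠ 0 :=
    hgen _ (by omega) (by have := j.isLt; omega)
  have hk : ∀ k, b k = false → quantumInt q (leftLabel b k) =
      quantumInt q (leftLabel (Function.update b i false) k) *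
      (if (j : ℕ) + 1 ≤ (k : ℕ) then quantumInt q (leftLabel (Function.update b i false) k + 1) /
        quantumInt q (leftLabel (Function.update b i false) k) else 1) := by
    intro k hk
    have hki : k ≠ i := by rintro rfl; simp [hi'.2] at hk
    have hkj : j ≠ k := by rintro rfl; simp [hj'.2] at hk
    have e : j ≤ k ↔ (j : ℕ) + 1 ≤ (k : ℕ) := by
      rw [Nat.succ_le_iff]; exact le_iff_lt_or_eq.trans (by simp [hkj])
    rw [leftLabel_flip_next h k]
    simp only [e]
    split_ifs with c
    · rw [mul_div_cancel₀]
      exact hgen _ (one_le_leftLabel (by simp [hki, hk])) (leftLabel_le _ _)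
    · simp
  have hr : ∀ k ∈ downArrows b, rightLabel (Function.update b i false) k = rightLabel b k := by
    intro k hk
    have hjk := (mem_downArrows.1 hk).1.up_lt_down (mem_downArrows.1 hk).2 hj'.1 hj'.2
    rw [rightLabel_eq_sum, rightLabel_eq_sum, h.arcs_flip, h.downArrows_flip,
      Finset.sum_insert h.not_mem_arcs, if_neg (not_le.2 hjk), zero_add]
  have h4 : psiN4 q (Function.update b i false) = psiN4 q b := by
    rw [psiN4, psiN4, h.downArrows_flip]
    exact Finset.prod_congr rfl fun k hk => by rw [hr k hk]
  have h3 : psiN3 q (Function.update b i false) * quantumInt q (((j : ℕ) - (i : ℕ) + 1) / 2) =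
      psiN3 q b := by
    rw [psiN3, psiN3, h.arcs_flip, Finset.prod_insert h.not_mem_arcs]
    field_simp
  have h2 : psiN2 q b * quantumInt q (leftLabel (Function.update b i false) i) =
      psiN2 q (Function.update b i false) *
        labelShift q (Function.update b i false) (j + 1) := by
    rw [labelShift, prod_false_eq, psiN2, psiN2, h.arcs_flip, h.downArrows_flip,
      Finset.prod_insert h.not_mem_arcs, Finset.prod_insert h.not_mem_arcs,
      Finset.prod_congr (s₁ := arcs b) rfl fun p hp => hk p.1 (mem_arcs.1 hp).left_eq,
      Finset.prod_congr (s₁ := downArrows b) rfl fun k hkd => hk k (mem_downArrows.1 hkd).2,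
      Finset.prod_mul_distrib, Finset.prod_mul_distrib, if_neg (by simp only; omega)]
    ring
  rw [labelCoeff, labelCoeff, h4, ← h3]
  linear_combination (psiN3 q (Function.update b i false) *
    quantumInt q (((j : ℕ) - (i : ℕ) + 1) / 2) * psiN4 q b) * h2

theorem labelShift_self (q : K) (b : Word N) : labelShift q b N = 1 :=
  Finset.prod_eq_one fun k _ => by
    rw [if_neg (not_le.2 k.isLt), ite_self]

theorem rightLabel_eq_of_isBoundary {i : Fin N} (hi : IsBoundary b i) :
    downCount b N = downCount b i + rightLabel b i := by
  rw [downCount_eq, downCount_eq, rightLabel_eq_sum]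
  have h1 : (∑ p ∈ arcs b, if (p.1 : ℕ) < N then 1 else 0) =
      (∑ p ∈ arcs b, if (p.1 : ℕ) < i then 1 else 0) + ∑ p ∈ arcs b, if i ≤ p.2 then 1 else 0 := by
    rw [← Finset.sum_add_distrib]
    refine Finset.sum_congr rfl fun p hp => ?_
    rw [mem_arcs] at hp
    by_cases h : (p.1 : ℕ) < i
    · have h' : p.2 < i := hi.1 _ _ hp h
      simp [h, h']
    · have : i ≤ p.2 := (not_lt.1 h).trans hp.lt.le
      simp [h, this]
  have h2 : (∑ k ∈ downArrows b, if (k : ℕ) < N then 1 else 0) =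
      (∑ k ∈ downArrows b, if (k : ℕ) < i then 1 else 0) +
        ∑ k ∈ downArrows b, if i ≤ k then 1 else 0 := by
    rw [← Finset.sum_add_distrib]
    refine Finset.sum_congr rfl fun k hk => ?_
    have h : i ≤ k := hi.2 k hk
    simp [h, not_lt.2 h]
  rw [h1, h2]
  ring

theorem downCount_le (b : Word N) (x : ℕ) : downCount b x ≤ N := by
  rw [downCount, ← Finset.card_filter]
  simpa using Finset.card_filter_le Finset.univ fun k => b k = false ∧ (k : ℕ) < x

theorem labelCoeff_flip_last (hgen : ∀ m, 1 ≤ m → m ≤ N → quantumInt q m ≠ 0) {i : Fin N}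
    (hi : i ∈ upArrows b) (h : ∀ k ∈ upArrows b, k ≤ i) :
    labelCoeff q b * quantumInt q (leftLabel (Function.update b i false) i) =
      labelCoeff q (Function.update b i false) *
        quantumInt q (rightLabel (Function.update b i false) i) := by
  have hi' := mem_upArrows.1 hi
  have hid := not_mem_downArrows_of_mem_upArrows hi
  have hm : quantumInt q (rightLabel (Function.update b i false) i) ≠ 0 := by
    apply hgen
    · rw [rightLabel_eq_sum, downArrows_flip_last hi h, Finset.sum_insert hid, if_pos le_rfl]
      omega
    · have h1 := rightLabel_eq_of_isBoundary (isBoundary_flip hi)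
      have h2 := downCount_le (Function.update b i false) N
      omega
  have hr : ∀ k ∈ downArrows b, rightLabel (Function.update b i false) k = rightLabel b k := by
    intro k hk
    have hik := (mem_downArrows.1 hk).1.up_lt_down (mem_downArrows.1 hk).2 hi'.1 hi'.2
    rw [rightLabel_eq_sum, rightLabel_eq_sum, arcs_flip_last hi h, downArrows_flip_last hi h,
      Finset.sum_insert hid, if_neg (not_le.2 hik), zero_add]
  have h2 : psiN2 q (Function.update b i false) =
      psiN2 q b * quantumInt q (leftLabel (Function.update b i false) i) := by
    rw [psiN2, psiN2, arcs_flip_last hi h, downArrows_flip_last hi h, Finset.prod_insert hid]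
    simp only [leftLabel_flip_last hi h]
    ring
  have h3 : psiN3 q (Function.update b i false) = psiN3 q b := by
    rw [psiN3, psiN3, arcs_flip_last hi h]
  have h4 : psiN4 q (Function.update b i false) *
      quantumInt q (rightLabel (Function.update b i false) i) = psiN4 q b := by
    rw [psiN4, psiN4, downArrows_flip_last hi h, Finset.prod_insert hid,
      Finset.prod_congr (s₁ := downArrows b) rfl fun k hk => by rw [hr k hk]]
    field_simp
  rw [labelCoeff, labelCoeff, h2, h3, ← h4]
  ring

theorem card_filter_upArrows_eq_upCount_flip {i : Fin N} (hi : i ∈ upArrows b) :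
    ((upArrows b).filter fun k => k ≤ i).card = upCount (Function.update b i false) i + 1 := by
  rw [card_filter_le_eq_succ hi, Finset.card_filter, upCount]
  congr 1
  simp only [Fin.val_fin_lt]
  by_cases hn : ∃ j, IsNextUp b i j
  · obtain ⟨j, h⟩ := hn
    rw [h.upArrows_flip, ← Finset.add_sum_erase _ _ h.1,
      ← Finset.add_sum_erase _ _ (Finset.mem_erase.2 ⟨h.2.2.1.ne', h.2.1⟩)]
    simp [h.2.2.1.le]
  · rw [upArrows_flip_last hi fun k hk => not_lt.1 fun h => hn (exists_isNextUp hi hk h),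
      ← Finset.add_sum_erase _ _ hi]
    simp

end FlipCoeff

section RootSum

variable {K : Type*} [Field K] {N : ℕ} {b : Word N} {q : K}

theorem labelShift_succ (hgen : ∀ m, 1 ≤ m → m ≤ N → quantumInt q m ≠ 0) (b : Word N)
    (i : Fin N) (hi : i ∉ upArrows b) :
    labelShift q b i * quantumInt q (upCount b i + downCount b i + 1) =
      labelShift q b (i + 1) * quantumInt q (upCount b (i + 1) + downCount b (i + 1) + 1) := by
  rw [upCount_succ, if_neg hi, downCount_succ, add_zero]
  have h : labelShift q b i = (if b i = false then quantumInt q (leftLabel b i + 1) /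
      quantumInt q (leftLabel b i) else 1) * labelShift q b (i + 1) := by
    rw [labelShift, labelShift, ← Finset.mul_prod_erase _ _ (Finset.mem_univ i),
      ← Finset.mul_prod_erase (a := i) _ (fun k : Fin N => if b k = false then
        (if (i : ℕ) + 1 ≤ (k : ℕ) then quantumInt q (leftLabel b k + 1) /
          quantumInt q (leftLabel b k) else 1) else 1) (Finset.mem_univ i)]
    simp only [le_refl, if_true, Nat.not_succ_le_self, if_false, ite_self, one_mul]
    congr 1
    refine Finset.prod_congr rfl fun k hk => ?_
    have hki : (k : ℕ) ≠ i := fun h => Finset.ne_of_mem_erase hk (Fin.ext h)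
    have : (i : ℕ) ≤ k ↔ (i : ℕ) + 1 ≤ k := by omega
    simp only [this]
  rw [h]
  cases hb : b i
  · have h1 := leftLabel_eq_of_false hb
    have h2 := hgen _ (one_le_leftLabel hb) (leftLabel_le b i)
    rw [← h1]
    simp only [if_true]
    rw [show upCount b i + (downCount b i + 1) + 1 = leftLabel b i + 1 by rw [h1]; ring]
    field_simp
  · simp

theorem labelShift_eq_of_no_upArrows (hgen : ∀ m, 1 ≤ m → m ≤ N → quantumInt q m ≠ 0)
    (b : Word N) {i x : ℕ} (hix : i ≤ x) (hx : x ≤ N)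
    (h : ∀ k ∈ upArrows b, i ≤ (k : ℕ) → x ≤ (k : ℕ)) :
    upCount b x = upCount b i ∧
    labelShift q b i * quantumInt q (upCount b i + downCount b i + 1) =
      labelShift q b x * quantumInt q (upCount b x + downCount b x + 1) := by
  induction x, hix using Nat.le_induction with
  | base => exact ⟨rfl, rfl⟩
  | succ x hix ih =>
    obtain ⟨h1, h2⟩ := ih (by omega) fun k hk hik => by have := h k hk hik; omega
    have hxu : (⟨x, hx⟩ : Fin N) ∉ upArrows b := fun hm => by
      have := h _ hm hix
      simp only at this
      omega
    refine ⟨?_, h2.trans (labelShift_succ hgen b ⟨x, hx⟩ hxu)⟩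
    have := upCount_succ b ⟨x, hx⟩
    rw [if_neg hxu, add_zero] at this
    exact this.trans h1

/-- The coefficient with which `b` with the down arrow `i` turned up contributes to `b` under
the lowering operator. -/
def rootTerm (q : K) (b : Word N) (i : Fin N) : K :=
  quantumInt q ((upArrows (Function.update b i true)).filter fun k => k ≤ i).card *
    labelCoeff q (Function.update b i true)

/-- `e` is the position after the end of the arc starting at `i`, or the number of positions if
`i` is an unpaired down arrow. -/
def IsBlockEnd (b : Word N) (i : Fin N) (e : ℕ) : Prop :=
  (∃ j : Fin N, IsArc b i j ∧ e = j + 1) ∨ (i ∈ downArrows b ∧ e = N)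

theorem IsBlockEnd.left_eq {i : Fin N} {e : ℕ} (h : IsBlockEnd b i e) : b i = false := by
  rcases h with ⟨j, h, -⟩ | ⟨h, -⟩
  · exact h.left_eq
  · exact (mem_downArrows.1 h).2

theorem IsBlockEnd.bounds {i : Fin N} {e : ℕ} (h : IsBlockEnd b i e) : (i : ℕ) < e ∧ e ≤ N := by
  rcases h with ⟨j, h, rfl⟩ | ⟨h, rfl⟩
  · exact ⟨Nat.lt_succ_of_lt h.lt, j.isLt⟩
  · exact ⟨i.isLt, le_rfl⟩

theorem IsBlockEnd.no_upArrows {i : Fin N} {e : ℕ} (h : IsBlockEnd b i e) :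
    ∀ k ∈ upArrows b, (i : ℕ) ≤ (k : ℕ) → e ≤ (k : ℕ) := by
  intro k hk hik
  rw [mem_upArrows] at hk
  have hne : i ≠ k := by
    rintro rfl
    simp [h.left_eq] at hk
  have hik : i < k := lt_of_le_of_ne hik hne
  rcases h with ⟨j, h, rfl⟩ | ⟨h, rfl⟩
  · exact hk.1.not_between h hik
  · exact absurd ((mem_downArrows.1 h).1.up_lt_down (mem_downArrows.1 h).2 hk.1 hk.2) hik.not_gt

theorem IsBlockEnd.not_isBoundary {i k : Fin N} {e : ℕ} (h : IsBlockEnd b i e) (hik : i < k)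
    (hke : (k : ℕ) < e) : ¬ IsBoundary b k := by
  intro hk
  rcases h with ⟨j, h, rfl⟩ | ⟨h, rfl⟩
  · have : (j : ℕ) < k := hk.1 i j h hik
    omega
  · exact (hk.2 i h).not_gt hik

theorem IsBlockEnd.labelCoeff_update (hgen : ∀ m, 1 ≤ m → m ≤ N → quantumInt q m ≠ 0)
    {i : Fin N} {e : ℕ} (h : IsBlockEnd b i e) (hi : IsBoundary b i) :
    ∃ m, downCount b e = downCount b i + m ∧
      labelCoeff q (Function.update b i true) * quantumInt q (leftLabel b i) =
        labelCoeff q b * quantumInt q m * labelShift q b e := by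
  have hmem := mem_upArrows_update_of_isBoundary hi
  have hb : Function.update (Function.update b i true) i false = b := by
    rw [Function.update_idem, ← h.left_eq, Function.update_eq_self]
  by_cases hn : ∃ j, IsNextUp (Function.update b i true) i j
  · obtain ⟨j, hj⟩ := hn
    have harc := hj.isArc_flip
    have hflip := labelCoeff_flip_next hgen hj
    rw [hb] at harc hflip
    have he : e = j + 1 := by
      rcases h with ⟨j', h, rfl⟩ | ⟨h, rfl⟩
      · rw [h.right_unique harc]
      · exact absurd harc ((mem_downArrows.1 h).1 j).1
    rw [he]
    exact ⟨_, downCount_sub_of_isArc harc, hflip⟩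
  · have hlast : ∀ k ∈ upArrows (Function.update b i true), k ≤ i := fun k hk =>
      not_lt.1 fun h => hn (exists_isNextUp hmem hk h)
    have hflip := labelCoeff_flip_last hgen hmem hlast
    have hdown := downArrows_flip_last hmem hlast
    rw [hb] at hflip hdown
    have hid : i ∈ downArrows b := by rw [hdown]; exact Finset.mem_insert_self _ _
    have he : e = N := by
      rcases h with ⟨j', h, rfl⟩ | ⟨h, rfl⟩
      · exact absurd h ((mem_downArrows.1 hid).1 j').1
      · rfl
    rw [he, labelShift_self]
    exact ⟨_, rightLabel_eq_of_isBoundary hi, by rw [mul_one, hflip]⟩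

theorem IsBlockEnd.rootTerm_eq (hq : q ≠ 0) (hgen : ∀ m, 1 ≤ m → m ≤ N → quantumInt q m ≠ 0)
    {i : Fin N} {e : ℕ} (h : IsBlockEnd b i e) (hi : IsBoundary b i) :
    labelCoeff q b * (quantumInt q (downCount b i) * labelShift q b i) + rootTerm q b i =
      labelCoeff q b * (quantumInt q (downCount b e) * labelShift q b e) := by
  obtain ⟨m, hm, hc⟩ := h.labelCoeff_update hgen hi
  obtain ⟨hU, hP⟩ := labelShift_eq_of_no_upArrows hgen b h.bounds.1.le h.bounds.2 h.no_upArrows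
  have hmem := mem_upArrows_update_of_isBoundary hi
  have hb : Function.update (Function.update b i true) i false = b := by
    rw [Function.update_idem, ← h.left_eq, Function.update_eq_self]
  have hr := card_filter_upArrows_eq_upCount_flip hmem
  rw [hb] at hr
  have hl := leftLabel_eq_of_false h.left_eq
  have hl0 := hgen _ (one_le_leftLabel h.left_eq) (leftLabel_le b i)
  have hid := quantumInt_mul_sub hq (downCount b i) m (upCount b i + 1)
  rw [rootTerm, hr, hm]
  rw [hU, hm] at hP
  rw [show upCount b i + 1 + downCount b i = leftLabel b i by rw [hl]; ring,
    show leftLabel b i + m = upCount b i + (downCount b i + m) + 1 by rw [hl]; ring] at hid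
  rw [← hl] at hP
  apply mul_right_cancel₀ hl0
  linear_combination labelCoeff q b * quantumInt q (downCount b i) * hP +
    quantumInt q (upCount b i + 1) * hc - labelCoeff q b * labelShift q b e * hid

open Classical in
/-- The sum of `rootTerm` over the down arrows before `x` which can be turned up. -/
def rootSum (q : K) (b : Word N) (x : ℕ) : K :=
  ∑ i : Fin N, if (b i = false ∧ IsBoundary b i) ∧ (i : ℕ) < x then rootTerm q b i else 0

theorem IsBlockEnd.rootSum_eq {i : Fin N} {e : ℕ} (h : IsBlockEnd b i e) (hi : IsBoundary b i) :
    rootSum q b e = rootSum q b i + rootTerm q b i := by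
  classical
  have h1 : rootTerm q b i = ∑ k, if k = i then rootTerm q b k else 0 := by simp
  rw [h1, rootSum, rootSum, ← Finset.sum_add_distrib]
  refine Finset.sum_congr rfl fun k _ => ?_
  have hie := h.bounds.1
  rcases lt_trichotomy k i with hk | rfl | hk
  · have hk' : (k : ℕ) < i := hk
    simp [hk.ne, hk', hk'.trans hie]
  · simp [h.left_eq, hi, hie]
  · have hk' : ¬ (k : ℕ) < i := not_lt.2 hk.le
    have : ¬ ((b k = false ∧ IsBoundary b k) ∧ (k : ℕ) < e) :=
      fun h' => h.not_isBoundary hk h'.2 h'.1.2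
    simp [hk.ne', hk', this]

theorem rootSum_eq_of_isBoundary (hq : q ≠ 0)
    (hgen : ∀ m, 1 ≤ m → m ≤ N → quantumInt q m ≠ 0) {x : ℕ} (hx : x ≤ N) (hb : IsBoundary b x) :
    rootSum q b x = labelCoeff q b * (quantumInt q (downCount b x) * labelShift q b x) := by
  induction x using Nat.strong_induction_on with
  | _ x ih =>
  rcases x with _ | x
  · simp [rootSum]
  set y : Fin N := ⟨x, hx⟩ with hy
  by_cases hyu : IsUnpaired b y
  · cases hby : b y
    · exact absurd (hb.2 y (mem_downArrows.2 ⟨hyu, hby⟩)) (by simp [hy])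
    · have hbx : IsBoundary b x := by
        refine ⟨fun k l hkl hk => ?_, fun k hk => (Nat.le_succ x).trans (hb.2 k hk)⟩
        have h1 := hb.1 k l hkl (hk.trans (Nat.lt_succ_self x))
        have h2 : (l : ℕ) ≠ x := fun h => by
          rw [show l = y from Fin.ext h] at hkl
          exact (hyu k).2 hkl
        omega
      have h1 : rootSum q b (x + 1) = rootSum q b x := by
        rw [rootSum, rootSum]
        refine Finset.sum_congr rfl fun k _ => ?_
        by_cases hk : k = y
        · simp [hk, hby]
        · have : (k : ℕ) ≠ x := fun h => hk (Fin.ext h)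
          have : (k : ℕ) < x + 1 ↔ (k : ℕ) < x := by omega
          congr 1
          exact propext (and_congr_right' this)
      have h2 : downCount b (x + 1) = downCount b x := by
        have := downCount_succ b y
        simpa [hby] using this
      have h3 : labelShift q b (x + 1) = labelShift q b x := by
        rw [labelShift, labelShift]
        refine Finset.prod_congr rfl fun k _ => ?_
        by_cases hk : k = y
        · simp [hk, hby]
        · have : (k : ℕ) ≠ x := fun h => hk (Fin.ext h)
          have : x + 1 ≤ (k : ℕ) ↔ x ≤ (k : ℕ) := by omega
          simp only [this]
      rw [h1, h2, h3]
      exact ih x (Nat.lt_succ_self x) (by omega) hbx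
  · cases hby : b y
    · obtain ⟨l, hl⟩ := exists_isArc_of_not_isUnpaired_of_false hyu hby
      have h1 : (l : ℕ) < x + 1 := hb.1 y l hl (Nat.lt_succ_self x)
      have h2 : x < (l : ℕ) := hl.lt
      omega
    · obtain ⟨k, hk⟩ := exists_isArc_of_not_isUnpaired_of_true hyu hby
      have hkx : (k : ℕ) < x := hk.lt
      have hbk : IsBoundary b k := by
        refine ⟨fun a c hac hak => ?_, fun c hc => by have := hb.2 c hc; omega⟩
        by_contra hck
        have h1 := hb.1 a c hac (by omega)
        have h2 : k ≠ c := by rintro rfl; simpa [hk.left_eq] using hac.right_eq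
        have h3 : k < c := lt_of_le_of_ne (not_lt.1 hck) h2
        have h4 : c ≠ y := by
          rintro rfl
          exact hak.ne (congrArg Fin.val (hac.left_unique hk))
        have h5 : c < y := lt_of_le_of_ne (Nat.lt_succ_iff.1 h1) h4
        exact (hk.lt_left hac h3 h5).not_gt hak
      have hblock : IsBlockEnd b k (x + 1) := .inl ⟨y, hk, rfl⟩
      rw [hblock.rootSum_eq hbk, ih k (by omega) (by omega) hbk, hblock.rootTerm_eq hq hgen hbk]

theorem rootSum_eq (hq : q ≠ 0) (hgen : ∀ m, 1 ≤ m → m ≤ N → quantumInt q m ≠ 0) (b : Word N) :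
    rootSum q b N = quantumInt q (minusCount b) * labelCoeff q b := by
  rw [← downCount_eq_minusCount]
  rcases (downArrows b).eq_empty_or_nonempty with h | h
  · rw [rootSum_eq_of_isBoundary hq hgen le_rfl ⟨fun _ l _ _ => l.isLt, by simp [h]⟩,
      labelShift_self]
    ring
  · obtain ⟨i, hi, hmin⟩ : ∃ i ∈ downArrows b, ∀ k ∈ downArrows b, i ≤ k :=
      ⟨_, Finset.min'_mem _ h, fun k => Finset.min'_le _ k⟩
    have hbi : IsBoundary b i :=
      ⟨fun k l hkl hk => (mem_downArrows.1 hi).1.not_between hkl hk, hmin⟩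
    have hblock : IsBlockEnd b i N := .inr ⟨hi, rfl⟩
    rw [hblock.rootSum_eq hbi, rootSum_eq_of_isBoundary hq hgen i.isLt.le hbi,
      hblock.rootTerm_eq hq hgen hbi, labelShift_self]
    ring

end RootSum

section PsiEq

variable {K : Type*} [Field K] {N : ℕ} {q Q : K}

theorem minusCount_eq (b : Word N) : minusCount b = (arcs b).card + (downArrows b).card := by
  rw [minusCount, Finset.card_filter, sum_false_eq]
  simp

theorem psiDeg_add_minusCount (b : Word N) : psiDeg b + minusCount b = N := by
  have h : ∑ _i : Fin N, 1 = N := by simp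
  rw [sum_eq_sum_arcs_add b] at h
  simp only [Finset.sum_const, smul_eq_mul] at h
  rw [psiDeg, minusCount_eq]
  omega

theorem minusCount_update {ε : Word N} {i : Fin N} (hi : ε i = false) :
    minusCount (Function.update ε i true) + 1 = minusCount ε := by
  have h : (Finset.univ.filter fun k => Function.update ε i true k = false) =
      (Finset.univ.filter fun k => ε k = false).erase i := by
    ext k
    by_cases hk : k = i
    · subst hk; simp
    · simp [hk]
  rw [minusCount, h, Finset.card_erase_add_one (by simp [hi]), minusCount]

theorem psiN1_update {b : Word N} {i : Fin N} (hi : b i = false) :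
    psiN1 q Q (Function.update b i true) = psiN1 q Q b * (Q * q ^ (N - minusCount b)) := by
  have h1 := psiDeg_add_minusCount b
  have h2 := psiDeg_add_minusCount (Function.update b i true)
  have h3 := minusCount_update hi
  have h4 : psiDeg (Function.update b i true) = psiDeg b + 1 := by omega
  have h5 : N - minusCount b = psiDeg b := by omega
  rw [psiN1, psiN1, h4, h5, Nat.triangle_succ]
  ring

theorem minusCount_eq_of_klVector_ne_zero {b ε : Word N} (h : klVector q b ε ≠ 0) :
    minusCount b = minusCount ε := by
  simp only [klVector, mul_ne_zero_iff, Finset.prod_ne_zero_iff] at h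
  obtain ⟨⟨h1, h2⟩, h3⟩ := h
  rw [minusCount, minusCount, Finset.card_filter, Finset.card_filter, sum_eq_sum_arcs_add b,
    sum_eq_sum_arcs_add b]
  congr 1
  · congr 1
    · refine Finset.sum_congr rfl fun p hp => ?_
      have h4 := mem_arcs.1 hp
      have h5 := h1 p hp
      rw [h4.left_eq, h4.right_eq]
      cases h6 : ε p.1 <;> cases h7 : ε p.2 <;> simp_all [arcCoeff]
    · refine Finset.sum_congr rfl fun k hk => ?_
      have h4 := h2 k hk
      rw [(mem_upArrows.1 hk).2]
      cases h6 : ε k <;> simp_all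
  · refine Finset.sum_congr rfl fun k hk => ?_
    have h4 := h3 k hk
    rw [(mem_downArrows.1 hk).2]
    cases h6 : ε k <;> simp_all

theorem Psi_apply (ε : Word N) :
    Psi N q Q ε = ∑ b : Word N, psiN1 q Q b * labelCoeff q b * klVector q b ε := by
  simp only [Psi, Finset.sum_apply, Pi.smul_apply, smul_eq_mul, labelCoeff, mul_assoc]

theorem lower_Psi_eq_sum (ε : Word N) : lower q (Psi N q Q) ε =
    ∑ b : Word N, psiN1 q Q b * labelCoeff q b * lower q (klVector q b) ε := by
  simp only [lower, Finset.mul_sum]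
  rw [Finset.sum_comm]
  refine Finset.sum_congr rfl fun i _ => ?_
  simp only [lowerAt]
  split_ifs
  · rw [Psi_apply, Finset.mul_sum]
    exact Finset.sum_congr rfl fun b _ => by ring
  · simp

/-- `Ψ` is mapped by the lowering operator like the product state. -/
theorem lower_Psi (hq : q ≠ 0) (hgen : ∀ m, 1 ≤ m → m ≤ N → quantumInt q m ≠ 0) (ε : Word N) :
    lower q (Psi N q Q) ε =
      Q * q ^ (N - minusCount ε) * quantumInt q (minusCount ε) * Psi N q Q ε := by
  classical
  have hinv : ∀ i : Fin N, Function.Involutive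
      fun b : Word N => Function.update b i (!b i) := fun i b => by simp
  have h1 : lower q (Psi N q Q) ε = ∑ i : Fin N, ∑ b : Word N,
      if i ∈ upArrows b then psiN1 q Q b * labelCoeff q b *
        (quantumInt q ((upArrows b).filter fun k => k ≤ i).card *
          klVector q (Function.update b i false) ε) else 0 := by
    rw [lower_Psi_eq_sum, Finset.sum_comm]
    refine Finset.sum_congr rfl fun b _ => ?_
    rw [lower_klVector hq, Finset.mul_sum, Finset.sum_ite_mem, Finset.univ_inter]
  have h2 : ∀ i : Fin N, (∑ b : Word N,
      if i ∈ upArrows b then psiN1 q Q b * labelCoeff q b *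
        (quantumInt q ((upArrows b).filter fun k => k ≤ i).card *
          klVector q (Function.update b i false) ε) else 0) =
      ∑ b : Word N, Q * q ^ (N - minusCount b) * psiN1 q Q b * klVector q b ε *
        if (b i = false ∧ IsBoundary b i) ∧ (i : ℕ) < N then rootTerm q b i else 0 := by
    intro i
    rw [← Equiv.sum_comp (hinv i).toPerm]
    refine Finset.sum_congr rfl fun b _ => ?_
    simp only [Function.Involutive.coe_toPerm]
    rcases (Bool.eq_false_or_eq_true (b i)).symm with hb | hb
    · simp only [hb, Bool.not_false, mem_upArrows_update_iff hb, i.isLt, and_true, true_and]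
      split_ifs
      · rw [Function.update_idem, show Function.update b i false = b by
          rw [← hb, Function.update_eq_self], psiN1_update hb, rootTerm]
        ring
      · simp
    · have : i ∉ upArrows (Function.update b i (!b i)) := fun h => by
        simpa [hb] using (mem_upArrows.1 h).2
      refine (if_neg this).trans ?_
      simp [hb]
  rw [h1, Finset.sum_congr rfl fun i _ => h2 i, Finset.sum_comm, Psi_apply, Finset.mul_sum]
  refine Finset.sum_congr rfl fun b _ => ?_
  have h3 := rootSum_eq hq hgen b
  rw [rootSum] at h3
  rw [← Finset.mul_sum]
  by_cases h : klVector q b ε = 0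
  · rw [h]; ring
  · rw [← minusCount_eq_of_klVector_ne_zero h]
    linear_combination Q * q ^ (N - minusCount b) * psiN1 q Q b * klVector q b ε * h3

theorem eq_const_of_minusCount_eq_zero {ε : Word N} (h : minusCount ε = 0) :
    ε = fun _ => true := by
  funext k
  rw [minusCount, Finset.card_eq_zero, Finset.filter_eq_empty_iff] at h
  simpa using h (Finset.mem_univ k)

theorem Psi_apply_const_true : Psi N q Q (fun _ => true) = productState N q Q fun _ => true := by
  have hm : minusCount (fun _ : Fin N => true) = 0 := by simp [minusCount]
  have h0 := minusCount_eq (fun _ : Fin N => true)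
  rw [hm] at h0
  have ha : arcs (fun _ : Fin N => true) = ∅ := Finset.card_eq_zero.1 (by omega)
  have hd : downArrows (fun _ : Fin N => true) = ∅ := Finset.card_eq_zero.1 (by omega)
  have hdeg : psiDeg (fun _ : Fin N => true) = N := by
    have := psiDeg_add_minusCount (fun _ : Fin N => true)
    omega
  rw [Psi_apply, Finset.sum_eq_single_of_mem (fun _ => true) (Finset.mem_univ _)]
  · rw [psiN1, hdeg, labelCoeff, psiN2, psiN3, psiN4, klVector, ha, hd, productState]
    simp only [Finset.prod_empty, siteCoeff, if_true, Finset.prod_const_one, mul_one]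
    rw [Finset.prod_mul_distrib, Finset.prod_pow_eq_pow_sum,
      Fin.sum_univ_eq_sum_range fun i => N - 1 - i, Finset.sum_range_reflect (fun i => i),
      Finset.sum_range_id]
    simp [mul_comm]
  · intro b _ hb
    by_contra h
    have h1 := minusCount_eq_of_klVector_ne_zero (right_ne_zero_of_mul h)
    exact hb (eq_const_of_minusCount_eq_zero (h1.trans hm))

/-- `Ψ` is the product state. -/
theorem Psi_eq_productState (hq : q ≠ 0) (hQ : Q ≠ 0)
    (hgen : ∀ m, 1 ≤ m → m ≤ N → quantumInt q m ≠ 0) : Psi N q Q = productState N q Q := by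
  funext ε
  induction hk : minusCount ε generalizing ε with
  | zero => rw [eq_const_of_minusCount_eq_zero hk, Psi_apply_const_true]
  | succ k ih =>
    have h1 : lower q (Psi N q Q) ε = lower q (productState N q Q) ε := by
      refine Finset.sum_congr rfl fun i _ => ?_
      rw [lowerAt, lowerAt]
      split_ifs with hi
      · have := minusCount_update hi
        rw [ih _ (by omega)]
      · rfl
    rw [lower_Psi hq hgen, lower_productState hq] at h1
    refine mul_left_cancel₀ (mul_ne_zero (mul_ne_zero hQ (pow_ne_zero _ hq)) ?_) h1
    exact hgen _ (by omega) (minusCount_le ε)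

end PsiEq

section Generators

variable {K : Type*} [Field K] {N : ℕ} {q Q Q₀ : K}

theorem onSite_apply (i : Fin N) (A : Matrix Bool Bool K) (f : State K N) (ε : Word N) :
    onSite i A f ε = ∑ x, A (ε i) x * f (Function.update ε i x) := by
  rw [onSite, Matrix.toLin'_apply, Matrix.mulVec, dotProduct]
  simp only [Matrix.of_apply, ite_mul, zero_mul]
  rw [← Finset.sum_filter]
  refine Finset.sum_nbij' (fun η => η i) (fun x => Function.update ε i x) ?_ ?_ ?_ ?_ ?_
  · simp
  · intro x _
    simp only [Finset.mem_filter, Finset.mem_univ, true_and]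
    intro k hk
    simp [hk]
  · intro η hη
    simp only [Finset.mem_filter, Finset.mem_univ, true_and] at hη
    funext k
    by_cases hk : k = i
    · subst hk; simp
    · simp [hk, hη k hk]
  · simp
  · intro η hη
    simp only [Finset.mem_filter, Finset.mem_univ, true_and] at hη
    congr 2
    funext k
    by_cases hk : k = i
    · subst hk; simp
    · simp [hk, hη k hk]

theorem onSites_apply {i j : Fin N} (hij : i ≠ j) (A : Matrix (Bool × Bool) (Bool × Bool) K)
    (f : State K N) (ε : Word N) : onSites i j A f ε =
      ∑ x, A (ε i, ε j) x * f (Function.update (Function.update ε i x.1) j x.2) := by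
  have hupd : ∀ η : Word N, (∀ k, k ≠ i → k ≠ j → ε k = η k) →
      Function.update (Function.update ε i (η i)) j (η j) = η := by
    intro η hη
    funext k
    by_cases hkj : k = j
    · subst hkj; simp
    by_cases hki : k = i
    · subst hki; simp [hkj]
    · simp [hki, hkj, hη k hki hkj]
  rw [onSites, Matrix.toLin'_apply, Matrix.mulVec, dotProduct]
  simp only [Matrix.of_apply, ite_mul, zero_mul]
  rw [← Finset.sum_filter]
  refine Finset.sum_nbij' (fun η => (η i, η j))
    (fun x => Function.update (Function.update ε i x.1) j x.2) ?_ ?_ ?_ ?_ ?_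
  · simp
  · intro x _
    simp only [Finset.mem_filter, Finset.mem_univ, true_and]
    intro k hki hkj
    simp [hki, hkj]
  · intro η hη
    exact hupd η (by simpa using hη)
  · intro x _
    simp [hij]
  · intro η hη
    rw [hupd η (by simpa using hη)]

theorem productState_update_eq (ε : Word N) (i : Fin N) (x : Bool) :
    productState N q Q (Function.update ε i x) =
      siteCoeff N q Q i x * ∏ k ∈ Finset.univ.erase i, siteCoeff N q Q k (ε k) := by
  rw [productState, ← Finset.mul_prod_erase _ _ (Finset.mem_univ i), Function.update_self]
  congr 1
  refine Finset.prod_congr rfl fun k hk => ?_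
  rw [Function.update_of_ne (Finset.ne_of_mem_erase hk)]

theorem productState_update_update_eq (ε : Word N) {i j : Fin N} (hij : i ≠ j) (x y : Bool) :
    productState N q Q (Function.update (Function.update ε i x) j y) =
      siteCoeff N q Q i x * siteCoeff N q Q j y *
        ∏ k ∈ (Finset.univ.erase j).erase i, siteCoeff N q Q k (ε k) := by
  rw [productState_update_eq, ← Finset.mul_prod_erase _ _
    (Finset.mem_erase.2 ⟨hij, Finset.mem_univ i⟩), Function.update_self,
    Finset.prod_congr (s₁ := (Finset.univ.erase j).erase i) rfl fun k hk => by
      rw [Function.update_of_ne (Finset.ne_of_mem_erase hk)]]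
  ring

theorem eBulk_productState {n : ℕ} (hq : q ≠ 0) (i : Fin n) :
    eBulk q i (productState (n + 1) q Q) = 0 := by
  funext ε
  have hij : i.castSucc ≠ i.succ := (Fin.castSucc_lt_succ).ne
  have hc : siteCoeff (n + 1) q Q i.castSucc true = q * siteCoeff (n + 1) q Q i.succ true := by
    have : n + 1 - 1 - (i : ℕ) = (n + 1 - 1 - ((i : ℕ) + 1)) + 1 := by
      have := i.isLt; omega
    simp only [siteCoeff, if_true, Fin.val_castSucc, Fin.val_succ, this, pow_succ]
    ring
  rw [eBulk, onSites_apply hij]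
  simp only [productState_update_update_eq ε hij, Fintype.sum_prod_type, Fintype.sum_bool, hc]
  cases ε i.castSucc <;> cases ε i.succ <;> simp [bulkMatrix, siteCoeff] <;> (field_simp; ring)

theorem eRight_productState {n : ℕ} (hQ : Q ≠ 0) :
    eRight n Q (productState (n + 1) q Q) = 0 := by
  funext ε
  rw [eRight, onSite_apply]
  simp only [productState_update_eq, Fintype.sum_bool]
  cases ε (Fin.last n) <;> simp [rightMatrix, siteCoeff]
  field_simp
  ring

theorem eLeft_productState {n : ℕ} (hint : q ^ n * Q * Q₀ = 1) :
    eLeft n Q₀ (productState (n + 1) q Q) = 0 := by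
  have hQ₀ : Q₀ ≠ 0 := right_ne_zero_of_mul_eq_one hint
  have h : Q * q ^ n = Q₀⁻¹ := by
    exact eq_inv_of_mul_eq_one_left (by rw [← hint]; ring)
  funext ε
  rw [eLeft, onSite_apply]
  simp only [productState_update_eq, Fintype.sum_bool]
  cases ε 0 <;> simp [leftMatrix, siteCoeff, h]
  field_simp
  ring

theorem productState_ne_zero : productState N q Q ≠ 0 := fun h => by
  have := congrFun h fun _ => false
  simp [productState, siteCoeff] at this

end Generators

end TwoBoundaryTL

end

theorem mainTheorem6 {K : Type*} [Field K] (n : ℕ) (q Q Q₀ : K) (hq : q ≠ 0)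
    (hgen : ∀ m : ℕ, 1 ≤ m → m ≤ n + 1 → TwoBoundaryTL.quantumInt q m ≠ 0)
    (hint : q ^ n * Q * Q₀ = 1) :
    TwoBoundaryTL.eLeft n Q₀ (TwoBoundaryTL.Psi (n + 1) q Q) = 0 ∧
      ∀ a₀ aN : K,
        Module.End.HasEigenvector (TwoBoundaryTL.H2B n q Q Q₀ a₀ aN) 0
          (TwoBoundaryTL.Psi (n + 1) q Q) := by
  have hQ : Q ≠ 0 := right_ne_zero_of_mul (left_ne_zero_of_mul_eq_one hint)
  rw [TwoBoundaryTL.Psi_eq_productState hq hQ hgen]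
  refine ⟨TwoBoundaryTL.eLeft_productState hint, fun a₀ aN => ⟨?_,
    TwoBoundaryTL.productState_ne_zero⟩⟩
  rw [Module.End.mem_eigenspace_iff, TwoBoundaryTL.H2B, TwoBoundaryTL.H1B]
  simp [TwoBoundaryTL.eLeft_productState hint, TwoBoundaryTL.eRight_productState hQ,
    TwoBoundaryTL.eBulk_productState hq]
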